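/- Let $\mathcal X$ be a nonempty set, $\emptyset\neq\mathcal Y\subset\mathbb R$, and let $P$ be a probability measure on $\mathcal X\times\mathcal Y$, defined on a $\sigma$-algebra $\mathfrak A$ for which the coordinate map $(x,y)\mapsto y$ is measurable. Let $\mathcal F$ be a separable reflexive real Banach space with dual $\mathcal F^*$ and pairing $\langle w,w^*\rangle=w^*(w)$; let $\Phi\colon\mathcal X\to\mathcal F^*$ be such that $(x,y)\mapsto\Phi(x)$ is $\mathfrak A$-measurable (for the Borel $\sigma$-algebra of $\mathcal F^*$). Let $L\colon\mathbb R\to[0,+\infty[$ be convex, $p\in[1,+\infty[$, $\gamma>0$, and let $G\colon\mathcal F\to\,]-\infty,+\infty]$ be proper, lower semicontinuous and convex. Assume that there are $a,b\ge 0$ with $L(t)\le a+b|t|^p$ for all $t\in\mathbb R$, and that $\int|y|^p\,dP(x,y)<+\infty$ and $\int\|\Phi(x)\|^p\,dP(x,y)<+\infty$. Let $p^*\in\,]1,+\infty]$ with $1/p+1/p^*=1$. Denote by $f^*(x^*)=\sup_{x}\,\langle x,x^*\rangle-f(x)$ the Fenchel conjugate of a function $f$ on a Banach space, and by $\partial f(x)=\{x^*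 \mid f(x)+\langle v-x,x^*\rangle\le f(v)\ \ \forall v\}$ its subdifferential; $\mathcal F$ is identified with $\mathcal F^{**}$ and $\mathbb R$ with its dual. Minimization problems have extended-real objectives; a solution is a feasible point at which the objective is least among all feasible points (the least value may be $+\infty$). Consider $$\min_{(w,b)\in\mathcal F\times\mathbb R}\ \gamma\int L\big(y-\langle w,\Phi(x)\rangle-b\big)\,dP(x,y)+G(w),\tag{R}$$ $$\min_{(w,b,e)\in\mathcal F\times\mathbb R\times L^p(P)}\ \gamma\int L(e)\,dP+G(w)\quad\text{s.t. } y-\langle w,\Phi(x)\rangle-b=e(x,y)\ \text{ for }P\text{-a.a. }(x,y),\tag{P}$$ $$\min_{u\in L^{p^*}(P)}\ G^*\Big(\int u\,\Phi\,dP\Big)+\gamma\int L^*\Big(\frac{u}{\gamma}\Big)dP-\int y\,u\,dP\quad\text{s.t. }\int u\,dP=0.\tag{D}$$ Then all the integrals that occur are well defined ($\int L^*(u/\gamma)\,dP$ with value in $]-\infty,+\infty]$), and the following hold. 1. (R) and (P) are equivalent: for every $(w,b)$ there is exactly one $e\in L^p(P)$ with $(w,b,e)$ feasible for (P), and then the objectives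 of (P) at $(w,b,e)$ and of (R) at $(w,b)$ are equal; the two infima coincide; and $(w,b)$ is a solution of (R) if and only if $(w,b,e)$ is a solution of (P) for some $e$. 2. (D) is the Fenchel–Rockafellar dual of (P). That is, let $f(w,b,e)=\gamma\int L(e)\,dP+G(w)$, let $T\colon\mathcal F\times\mathbb R\times L^p(P)\to L^p(P)$ be the bounded linear operator $T(w,b,e)=-(\langle w,\Phi(\cdot)\rangle+b+e)$, and let $g$ be the indicator function ($0$ on the set, $+\infty$ off it) of the one-point set $\{-\mathrm{pr}_2\}$, where $\mathrm{pr}_2(x,y)=y$. Then (P) is the problem $\min\, f+g\circ T$; the map $u\mapsto\int(\cdot)\,u\,dP$ is a bijection of $L^{p^*}(P)$ onto $L^p(P)^*$; and, under it, the dual objective $f^*(-T^*u)+g^*(u)$ equals, for every $u\in L^{p^*}(P)$, the objective of (D) if $\int u\,dP=0$ and $+\infty$ otherwise. 3. (D) has a solution. 4. Strong duality: $\inf\text{(P)}=-\min\text{(D)}$ in $[-\infty,+\infty]$. 5. For every $(w,b,e)\in\mathcal F\times\mathbb R\times L^p(P)$ and every $u\in L^{p^*}(P)$: $(w,b,e)$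 is a solution of (P) and $u$ is a solution of (D) if and only if $$w\in\partial G^*\Big(\int u\,\Phi\,dP\Big),\qquad \int u\,dP=0,\qquad \frac{u(x,y)}{\gamma}\in\partial L(e(x,y))\ \text{ for }P\text{-a.a. }(x,y),$$ $$y-\langle w,\Phi(x)\rangle-b=e(x,y)\ \text{ for }P\text{-a.a. }(x,y).$$ -/

import Mathlib

open MeasureTheory
open scoped ENNReal

noncomputable section

namespace SVR

/-! ### Extended-real convex analysis -/

/-- `IsGammaZero G`: the function `G : E → ]-∞, +∞]` is proper, convex and lower semicontinuous.
The value `-∞` is excluded by the first field, so no `∞ - ∞` occurs in the convexity inequality. -/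
structure IsGammaZero {E : Type*} [NormedAddCommGroup E] [NormedSpace ℝ E] (G : E → EReal) :
    Prop where
  ne_bot : ∀ w, G w ≠ ⊥
  proper : ∃ w, G w ≠ ⊤
  convex : ∀ v w : E, ∀ s t : ℝ, 0 < s → 0 < t → s + t = 1 →
    G (s • v + t • w) ≤ (s : EReal) * G v + (t : EReal) * G w
  lsc : LowerSemicontinuous G

/-- The Fenchel conjugate `f*(φ) = sup_w ⟨w, φ⟩ - f(w)`, a function on the topological dual. -/
def fenchelConj {E : Type*} [NormedAddCommGroup E] [NormedSpace ℝ E] (f : E → EReal)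
    (φ : StrongDual ℝ E) : EReal :=
  ⨆ w : E, ((φ w : ℝ) : EReal) - f w

/-- The subdifferential `∂f(x) = {φ | ∀ v, f(x) + ⟨v - x, φ⟩ ≤ f(v)}`. -/
def subdifferential {E : Type*} [NormedAddCommGroup E] [NormedSpace ℝ E] (f : E → EReal) (x : E) :
    Set (StrongDual ℝ E) :=
  {φ | ∀ v : E, f x + ((φ (v - x) : ℝ) : EReal) ≤ f v}

/-- The indicator function of convex analysis: `0` on `C` and `+∞` off `C`. -/
def convexIndicator {E : Type*} (C : Set E) (x : E) : EReal :=
  open Classical in if x ∈ C then 0 else ⊤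

/-- The conjugate `L*(s) = sup_t s t - L(t)` of a real function, the dual of `ℝ` being `ℝ`. -/
def realConj (L : ℝ → ℝ) (s : ℝ) : EReal :=
  ⨆ t : ℝ, ((s * t - L t : ℝ) : EReal)

/-- The subdifferential of a finite function on the real line, the dual of `ℝ` being `ℝ`. -/
def realSubdifferential (L : ℝ → ℝ) (r : ℝ) : Set ℝ :=
  {s | ∀ t : ℝ, L r + s * (t - r) ≤ L t}

/-- The integral of an extended-real function: integral of the positive part minus integral of the
negative part. -/
def extIntegral {Ω : Type*} [MeasurableSpace Ω] (μ : Measure Ω) (f : Ω → EReal) : EReal :=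
  ((∫⁻ z, (f z).toENNReal ∂μ : ℝ≥0∞) : EReal) - ((∫⁻ z, (-f z).toENNReal ∂μ : ℝ≥0∞) : EReal)

/-- `x` is a solution of: minimize `h` over `C`. -/
def IsSolution {E : Type*} (h : E → EReal) (C : Set E) (x : E) : Prop :=
  x ∈ C ∧ ∀ v ∈ C, h x ≤ h v

/-- The optimal value of: minimize `h` over `C`. -/
def optimalValue {E : Type*} (h : E → EReal) (C : Set E) : EReal :=
  ⨅ x ∈ C, h x

/-- The objective `x ↦ f(x) + g(T x)` of the primal problem in Fenchel–Rockafellar duality. -/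
def frPrimal {E H : Type*} [NormedAddCommGroup E] [NormedSpace ℝ E] [NormedAddCommGroup H]
    [NormedSpace ℝ H] (f : E → EReal) (g : H → EReal) (T : E →L[ℝ] H) (x : E) : EReal :=
  f x + g (T x)

/-- The objective `η ↦ f*(-T*η) + g*(η)` of the dual problem in Fenchel–Rockafellar duality. -/
def frDual {E H : Type*} [NormedAddCommGroup E] [NormedSpace ℝ E] [NormedAddCommGroup H]
    [NormedSpace ℝ H] (f : E → EReal) (g : H → EReal) (T : E →L[ℝ] H) (η : StrongDual ℝ H) :
    EReal :=
  fenchelConj f (-(η.comp T)) + fenchelConj g η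

/-! ### Support vector regression -/

section

variable {X : Type*} {Y : Set ℝ} [MeasurableSpace (X × Y)]
  {F : Type*} [NormedAddCommGroup F] [NormedSpace ℝ F]

/-- The residual `(x, y) ↦ y - ⟨w, Φ(x)⟩ - b`. -/
def residual (Φ : X → StrongDual ℝ F) (w : F) (b : ℝ) (z : X × Y) : ℝ :=
  (z.2 : ℝ) - Φ z.1 w - b

/-- The regression objective `γ ∫ L(y - ⟨w, Φ(x)⟩ - b) dP(x,y) + G(w)`, a function of `(w, b)`. -/
def regObjective (P : Measure (X × Y)) (Φ : X → StrongDual ℝ F) (L : ℝ → ℝ) (γ : ℝ)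
    (G : F → EReal) (v : F × ℝ) : EReal :=
  (γ : EReal) * extIntegral P (fun z => ((L (residual Φ v.1 v.2 z) : ℝ) : EReal)) + G v.1

/-- The objective `γ ∫ L(e) dP + G(w)` of the constrained problem, a function of `(w, b, e)`. -/
def primalObjective (p : ℝ≥0∞) (P : Measure (X × Y)) (L : ℝ → ℝ) (γ : ℝ) (G : F → EReal)
    (v : F × ℝ × Lp ℝ p P) : EReal :=
  (γ : EReal) * extIntegral P (fun z => ((L (v.2.2 z) : ℝ) : EReal)) + G v.1

/-- The constraint `y - ⟨w, Φ(x)⟩ - b = e(x, y)` for `P`-almost all `(x, y)`. -/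
def primalFeasible (p : ℝ≥0∞) (P : Measure (X × Y)) (Φ : X → StrongDual ℝ F) :
    Set (F × ℝ × Lp ℝ p P) :=
  {v | ∀ᵐ z ∂P, residual Φ v.1 v.2.1 z = v.2.2 z}

/-- The element `∫ u(x,y) Φ(x) dP(x,y)` of the dual of the feature space. -/
def featureIntegral {q : ℝ≥0∞} (P : Measure (X × Y)) (Φ : X → StrongDual ℝ F) (u : Lp ℝ q P) :
    StrongDual ℝ F :=
  ∫ z, u z • Φ z.1 ∂P

/-- The dual objective `G*(∫ u Φ dP) + γ ∫ L*(u/γ) dP - ∫ y u dP`. -/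
def dualObjective (q : ℝ≥0∞) (P : Measure (X × Y)) (Φ : X → StrongDual ℝ F) (L : ℝ → ℝ) (γ : ℝ)
    (G : F → EReal) (u : Lp ℝ q P) : EReal :=
  fenchelConj G (featureIntegral P Φ u)
    + (γ : EReal) * extIntegral P (fun z => realConj L (u z / γ))
    - ((∫ z, (z.2 : ℝ) * u z ∂P : ℝ) : EReal)

/-- The dual constraint `∫ u dP = 0`. -/
def dualFeasible (q : ℝ≥0∞) (P : Measure (X × Y)) : Set (Lp ℝ q P) :=
  {u | ∫ z, u z ∂P = 0}

/-- The one-point set `{-pr₂}` in `L^p(P)`, where `pr₂(x, y) = y`. -/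
def negOutput (p : ℝ≥0∞) (P : Measure (X × Y)) : Set (Lp ℝ p P) :=
  {h | ∀ᵐ z ∂P, h z = -(z.2 : ℝ)}

/-- The map `u ↦ ⟨·, u⟩`, `⟨e, u⟩ = ∫ e u dP`, from `L^{p*}(P)` to the dual of `L^p(P)`. -/
def lpToDual (p q : ℝ≥0∞) [Fact (1 ≤ p)] [Fact (1 ≤ q)] [p.HolderConjugate q]
    (P : Measure (X × Y)) : Lp ℝ q P →L[ℝ] StrongDual ℝ (Lp ℝ p P) :=
  ((ContinuousLinearMap.mul ℝ ℝ).lpPairing P p q).flip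

end

end SVR

end

/-! Write J(e) = γ ∫ L(e) dP and A(w, b) = ⟨w, Φ(·)⟩ + b. Eliminating e turns the constrained
problem into the minimization of J(y - A(w, b)) + G(w). The growth bound makes J finite and locally
bounded on `L^p`, and a convex function bounded above near a point is continuous
(`continuous_integral_comp`). Continuity of J is the constraint qualification: the strict epigraph
of the value function under perturbations of y is open and convex and misses (0, m), where m is the
optimal value. If m is finite, a separating hyperplane cannot be vertical, and its slope is a dual
functional attaining -m (`exists_dual_functional`); if m = -∞, weak duality is enough.

That functional is a function u in `L^q`, by Radon–Nikodym and the converse of Hölder's inequality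
(`bijective_lpPairing_mul_flip`). Conjugating the primal objective at u separates the variables
(`dual_le_coe_iff`): the free b forces ∫ u = 0, the supremum over w gives G*(∫ u Φ), and the
supremum over e gives γ ∫ L*(u/γ). The last one exchanges supremum and integral by choosing
measurable, bounded near-maximizers pointwise and passing to the limit monotonically
(`extIntegral_realConj_le`).

For feasible points, the duality gap is the sum of two nonnegative Fenchel–Young gaps, one for G and
one integrated for L. With no gap between the optimal values, both points are optimal exactly when
both gaps vanish (`isSolution_pair_iff`). The G-equality amounts to w ∈ ∂G*(∫ u Φ) because G is the
supremum of its affine minorants.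

Reflexivity and separability of F make the dual of F separable, so that Φ is strongly measurable and
∫ u Φ is a Bochner integral. -/

/-! ### The dual of `L^p` -/

namespace MeasureTheory

open Filter Topology

variable {α : Type*} [MeasurableSpace α] {μ : Measure α} {p q : ℝ≥0∞}

section SignedMeasure

variable [IsFiniteMeasure μ] [Fact (1 ≤ p)]

open Classical in
/-- The set function `s ↦ φ(1_s)` attached to a functional on `L^p`. -/
noncomputable def Lp.dualSetFun (φ : StrongDual ℝ (Lp ℝ p μ)) (s : Set α) : ℝ :=
  if hs : MeasurableSet s then φ (indicatorConstLp p hs (measure_ne_top μ s) (1 : ℝ)) else 0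

theorem Lp.dualSetFun_of_measurable (φ : StrongDual ℝ (Lp ℝ p μ)) {s : Set α}
    (hs : MeasurableSet s) :
    Lp.dualSetFun φ s = φ (indicatorConstLp p hs (measure_ne_top μ s) (1 : ℝ)) := by
  simp [Lp.dualSetFun, hs]

theorem Lp.dualSetFun_empty (φ : StrongDual ℝ (Lp ℝ p μ)) : Lp.dualSetFun φ ∅ = 0 := by
  rw [Lp.dualSetFun_of_measurable φ MeasurableSet.empty, indicatorConstLp_empty, map_zero]

theorem Lp.dualSetFun_union (φ : StrongDual ℝ (Lp ℝ p μ)) {s t : Set α}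
    (hs : MeasurableSet s) (ht : MeasurableSet t) (hst : Disjoint s t) :
    Lp.dualSetFun φ (s ∪ t) = Lp.dualSetFun φ s + Lp.dualSetFun φ t := by
  rw [Lp.dualSetFun_of_measurable φ hs, Lp.dualSetFun_of_measurable φ ht,
    Lp.dualSetFun_of_measurable φ (hs.union ht),
    indicatorConstLp_disjoint_union hs ht (measure_ne_top μ s) (measure_ne_top μ t) hst, map_add]

theorem Lp.dualSetFun_biUnion (φ : StrongDual ℝ (Lp ℝ p μ)) {A : ℕ → Set α}
    (hA : ∀ i, MeasurableSet (A i)) (hd : Pairwise (Function.onFun Disjoint A)) (s : Finset ℕ) :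
    Lp.dualSetFun φ (⋃ i ∈ s, A i) = ∑ i ∈ s, Lp.dualSetFun φ (A i) := by
  induction s using Finset.induction_on with
  | empty => simp [Lp.dualSetFun_empty]
  | insert a s ha ih =>
    rw [Finset.set_biUnion_insert, Lp.dualSetFun_union φ (hA a)
      (s.measurableSet_biUnion fun i _ => hA i), ih, Finset.sum_insert ha]
    rw [Set.disjoint_iUnion₂_right]
    intro i hi
    exact hd (by rintro rfl; exact ha hi)

/-- The finite partial unions differ from the full union by sets of vanishing measure. For p < ∞
this is convergence of the indicators in `L^p`, and φ is continuous. -/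
theorem Lp.hasSum_dualSetFun (hp : p ≠ ∞) (φ : StrongDual ℝ (Lp ℝ p μ)) {A : ℕ → Set α}
    (hA : ∀ i, MeasurableSet (A i)) (hd : Pairwise (Function.onFun Disjoint A)) :
    HasSum (fun i => Lp.dualSetFun φ (A i)) (Lp.dualSetFun φ (⋃ i, A i)) := by
  have hfin : ∀ s : Finset ℕ, MeasurableSet (⋃ i ∈ s, A i) := fun s =>
    s.measurableSet_biUnion fun i _ => hA i
  have hlim : Tendsto (fun s : Finset ℕ => indicatorConstLp p (hfin s)
      (measure_ne_top μ _) (1 : ℝ)) atTop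
      (𝓝 (indicatorConstLp p (MeasurableSet.iUnion hA) (measure_ne_top μ _) (1 : ℝ))) := by
    apply tendsto_indicatorConstLp_set hp
    have hsum : ∑' i, μ (A i) ≠ ∞ := by
      rw [← measure_iUnion hd hA]; exact measure_ne_top μ _
    refine tendsto_of_tendsto_of_tendsto_of_le_of_le tendsto_const_nhds
      (ENNReal.tendsto_tsum_compl_atTop_zero hsum) (fun _ => zero_le) fun s => ?_
    refine (measure_mono (t := ⋃ i : {i // i ∉ s}, A i) ?_).trans (measure_iUnion_le _)
    intro z hz
    rcases hz with ⟨h1, h2⟩ | ⟨h1, h2⟩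
    · obtain ⟨i, _, hi⟩ := Set.mem_iUnion₂.1 h1
      exact absurd (Set.mem_iUnion.2 ⟨i, hi⟩) h2
    · obtain ⟨i, hi⟩ := Set.mem_iUnion.1 h1
      exact Set.mem_iUnion.2 ⟨⟨i, fun his => h2 (Set.mem_iUnion₂.2 ⟨i, his, hi⟩)⟩, hi⟩
  have h := (φ.continuous.tendsto _).comp hlim
  rw [← Lp.dualSetFun_of_measurable φ] at h
  refine h.congr fun s => ?_
  rw [← Lp.dualSetFun_biUnion φ hA hd s, Lp.dualSetFun_of_measurable φ (hfin s)]
  rfl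

/-- The signed measure `s ↦ φ(1_s)` attached to a functional on `L^p`, `p < ∞`. -/
noncomputable def Lp.dualSignedMeasure (hp : p ≠ ∞) (φ : StrongDual ℝ (Lp ℝ p μ)) :
    SignedMeasure α where
  measureOf' := Lp.dualSetFun φ
  empty' := Lp.dualSetFun_empty φ
  not_measurable' _ hs := by simp [Lp.dualSetFun, hs]
  m_iUnion' _ hA hd := Lp.hasSum_dualSetFun hp φ hA hd

/-- A functional on `L^p`, `p < ∞`, is represented on indicator functions by an integrable
function. -/
theorem Lp.exists_integrable_dual_indicator (hp : p ≠ ∞) (φ : StrongDual ℝ (Lp ℝ p μ)) :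
    ∃ u : α → ℝ, Measurable u ∧ Integrable u μ ∧ ∀ (s : Set α) (hs : MeasurableSet s),
      φ (indicatorConstLp p hs (measure_ne_top μ s) (1 : ℝ)) = ∫ z in s, u z ∂μ := by
  set ν := Lp.dualSignedMeasure hp φ
  have hac : ν ≪ᵥ μ.toENNRealVectorMeasure := by
    refine VectorMeasure.AbsolutelyContinuous.mk fun s hs h0 => ?_
    rw [Measure.toENNRealVectorMeasure_apply_measurable hs] at h0
    change Lp.dualSetFun φ s = 0
    rw [Lp.dualSetFun_of_measurable φ hs]
    -- Null sets have zero indicator in `L^p`; this gives absolute continuity, hence a Radon–Nikodym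
    -- density.
    have : indicatorConstLp p hs (measure_ne_top μ s) (1 : ℝ) = 0 := by
      rw [← norm_eq_zero, norm_indicatorConstLp
        (zero_lt_one.trans_le (Fact.out : 1 ≤ p)).ne' hp]
      have hpos : p.toReal ≠ 0 := (ENNReal.toReal_pos
        (zero_lt_one.trans_le (Fact.out : 1 ≤ p)).ne' hp).ne'
      simp [Measure.real, h0, hpos]
    rw [this, map_zero]
  refine ⟨ν.rnDeriv μ, SignedMeasure.measurable_rnDeriv _ _, SignedMeasure.integrable_rnDeriv _ _,
    fun s hs => ?_⟩
  rw [← withDensityᵥ_apply (SignedMeasure.integrable_rnDeriv ν μ) hs,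
    SignedMeasure.withDensityᵥ_rnDeriv_eq ν μ hac, ← Lp.dualSetFun_of_measurable φ hs]
  rfl

end SignedMeasure

/-- Two functionals on `L^p`, `p < ∞`, agree if they agree on indicator functions. -/
theorem Lp.dual_ext [IsFiniteMeasure μ] [Fact (1 ≤ p)] (hp : p ≠ ∞)
    {φ ψ : StrongDual ℝ (Lp ℝ p μ)}
    (h : ∀ (s : Set α) (hs : MeasurableSet s),
      φ (indicatorConstLp p hs (measure_ne_top μ s) (1 : ℝ)) =
        ψ (indicatorConstLp p hs (measure_ne_top μ s) (1 : ℝ))) : φ = ψ := by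
  ext f
  refine Lp.induction hp (fun f => φ f = ψ f) (fun c s hs hμs => ?_) (fun f g hf hg _ h1 h2 => ?_)
    (isClosed_eq φ.continuous ψ.continuous) f
  · rw [Lp.simpleFunc.coe_indicatorConst]
    have : indicatorConstLp p hs hμs.ne c =
        c • indicatorConstLp p hs (measure_ne_top μ s) (1 : ℝ) := by
      rw [indicatorConstLp, indicatorConstLp, ← MemLp.toLp_const_smul]
      congr 1
      ext z
      by_cases hz : z ∈ s <;> simp [hz]
    rw [this, map_smul, map_smul, h]
  · rw [map_add, map_add, h1, h2]

theorem lpPairing_mul_apply [p.HolderConjugate q] [Fact (1 ≤ p)] [Fact (1 ≤ q)]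
    (f : Lp ℝ p μ) (u : Lp ℝ q μ) :
    (ContinuousLinearMap.mul ℝ ℝ).lpPairing μ p q f u = ∫ z, f z * u z ∂μ := by
  rw [ContinuousLinearMap.lpPairing_eq_integral]; rfl

/-! ### The converse of Hölder's inequality. -/

/-- A sign function with values `1` and `-1`. -/
noncomputable def unitSign (t : ℝ) : ℝ := if 0 ≤ t then 1 else -1

theorem unitSign_mul_self (t : ℝ) : unitSign t * t = |t| := by
  unfold unitSign
  split_ifs with h
  · rw [abs_of_nonneg h, one_mul]
  · rw [abs_of_neg (not_le.1 h), neg_one_mul]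

theorem norm_unitSign (t : ℝ) : ‖unitSign t‖ = 1 := by
  unfold unitSign; split_ifs <;> simp

theorem measurable_unitSign : Measurable unitSign :=
  Measurable.ite measurableSet_Ici measurable_const measurable_const

/-- The converse of Hölder's inequality for finite exponents. -/
theorem eLpNorm_le_of_integral_mul_le_of_ne_top [p.HolderConjugate q]
    (hp : p ≠ ∞) (hq : q ≠ ∞) {w : α → ℝ} (hwm : Measurable w) (hw : MemLp w q μ) {C : ℝ}
    (hC : 0 ≤ C)
    (H : ∀ f : α → ℝ, MemLp f p μ → ∫ z, f z * w z ∂μ ≤ C * (eLpNorm f p μ).toReal) :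
    eLpNorm w q μ ≤ ENNReal.ofReal C := by
  have hpq : p.toReal.HolderConjugate q.toReal := ENNReal.HolderConjugate.toReal_of_ne_top hp hq
  have hq1 : 0 < q.toReal - 1 := hpq.symm.sub_one_pos
  -- The equality case of Hölder: f w = |w|^q, and |f|^p = |w|^q because (q - 1) p = q.
  set f : α → ℝ := fun z => unitSign (w z) * |w z| ^ (q.toReal - 1) with hf
  have hfm : Measurable f :=
    (measurable_unitSign.comp hwm).mul ((hwm.abs).pow_const _)
  have hfn : eLpNorm f p μ = eLpNorm w q μ ^ (q.toReal - 1) := by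
    have h1 : eLpNorm f p μ = eLpNorm (fun z => ‖w z‖ ^ (q.toReal - 1)) p μ := by
      refine eLpNorm_congr_norm_ae (ae_of_all _ fun z => ?_)
      rw [hf, norm_mul, norm_unitSign, one_mul, Real.norm_eq_abs (w z)]
    rw [h1, eLpNorm_norm_rpow w hq1]
    congr 2
    rw [← ENNReal.ofReal_toReal hp, ← ENNReal.ofReal_mul hpq.nonneg, mul_comm,
      hpq.symm.sub_one_mul_conj, ENNReal.ofReal_toReal hq]
  have hfL : MemLp f p μ := by
    refine ⟨hfm.aestronglyMeasurable, ?_⟩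
    rw [hfn]
    exact ENNReal.rpow_lt_top_of_nonneg hq1.le hw.2.ne
  set N : ℝ := (eLpNorm w q μ).toReal with hN
  have hN0 : 0 ≤ N := ENNReal.toReal_nonneg
  have hq0 : q ≠ 0 := fun h => by simp [h] at hq1; linarith
  have hint : ∫ z, f z * w z ∂μ = N ^ q.toReal := by
    have h1 : ∀ z, f z * w z = ‖w z‖ ^ q.toReal := fun z => by
      simp only [hf]
      rw [mul_right_comm, unitSign_mul_self, Real.norm_eq_abs, mul_comm,
        ← Real.rpow_add_one' (abs_nonneg _) (by linarith)]
      congr 1; ring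
    have hI : 0 ≤ ∫ z, ‖w z‖ ^ q.toReal ∂μ := integral_nonneg fun z => by positivity
    simp_rw [h1]
    rw [hN, hw.eLpNorm_eq_integral_rpow_norm hq0 hq, ENNReal.toReal_ofReal (by positivity),
      Real.rpow_inv_rpow hI (by linarith)]
  have hmain := H f hfL
  rw [hint, hfn, ← ENNReal.toReal_rpow, ← hN] at hmain
  rw [← ENNReal.ofReal_toReal hw.2.ne]
  apply ENNReal.ofReal_le_ofReal
  rw [← hN]
  rcases hN0.eq_or_lt with h0 | h0
  · rwa [← h0]
  · have h2 : N ^ q.toReal = N * N ^ (q.toReal - 1) := by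
      rw [mul_comm, ← Real.rpow_add_one h0.ne']; congr 1; ring
    rw [h2] at hmain
    exact le_of_mul_le_mul_right hmain (Real.rpow_pos_of_pos h0 _)

/-- The converse of Hölder's inequality for the exponents `1` and `∞`. -/
theorem eLpNorm_top_le_of_integral_mul_le [IsFiniteMeasure μ] {w : α → ℝ} (hwm : Measurable w)
    (hw : MemLp w ∞ μ) {C : ℝ}
    (H : ∀ f : α → ℝ, MemLp f 1 μ → ∫ z, f z * w z ∂μ ≤ C * (eLpNorm f 1 μ).toReal) :
    eLpNorm w ∞ μ ≤ ENNReal.ofReal C := by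
  set A : Set α := {z | C < |w z|} with hA
  have hAm : MeasurableSet A := measurableSet_lt measurable_const hwm.abs
  set f : α → ℝ := A.indicator fun z => unitSign (w z) with hf
  have hfm : Measurable f := (measurable_unitSign.comp hwm).indicator hAm
  have hfn : eLpNorm f 1 μ = μ A := by
    have h1 : eLpNorm f 1 μ = eLpNorm (A.indicator fun _ => (1 : ℝ)) 1 μ := by
      refine eLpNorm_congr_norm_ae (ae_of_all _ fun z => ?_)
      by_cases hz : z ∈ A
      · simpa [hf, hz] using norm_unitSign (w z)
      · simp [hf, hz]
    rw [h1, eLpNorm_indicator_const hAm one_ne_zero ENNReal.one_ne_top]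
    simp
  have hfL : MemLp f 1 μ := ⟨hfm.aestronglyMeasurable, by rw [hfn]; exact measure_lt_top μ A⟩
  have hwI : Integrable (fun z => |w z|) μ := (hw.integrable le_top).abs
  have hint : ∫ z, f z * w z ∂μ = ∫ z in A, |w z| ∂μ := by
    rw [← integral_indicator hAm]
    refine integral_congr_ae (ae_of_all _ fun z => ?_)
    by_cases hz : z ∈ A <;> simp [hf, hz, unitSign_mul_self]
  have hmain := H f hfL
  rw [hint, hfn] at hmain
  -- The integrand is positive on A, so a nonpositive integral makes A null.
  have hle : ∫ z in A, (|w z| - C) ∂μ ≤ 0 := by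
    rw [integral_sub hwI.integrableOn (integrable_const _).integrableOn, setIntegral_const,
      smul_eq_mul, Measure.real]
    linarith
  have hnn : 0 ≤ᵐ[μ.restrict A] fun z => |w z| - C :=
    (ae_restrict_iff' hAm).2 (ae_of_all _ fun z hz => sub_nonneg.2 (le_of_lt hz))
  have h0 := (integral_eq_zero_iff_of_nonneg_ae hnn
    (hwI.integrableOn.sub (integrable_const _).integrableOn)).1
    (le_antisymm hle (integral_nonneg_of_ae hnn))
  rw [EventuallyEq, ae_restrict_iff' hAm] at h0
  rw [eLpNorm_exponent_top]
  refine eLpNormEssSup_le_of_ae_bound ?_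
  filter_upwards [h0] with z hz
  by_contra hcon
  have hzA : z ∈ A := not_le.1 hcon
  have := hz hzA
  simp only [Pi.zero_apply] at this
  exact absurd hzA (by rw [hA]; simp; linarith)

/-- The converse of Hölder's inequality. -/
theorem eLpNorm_le_of_integral_mul_le [IsFiniteMeasure μ] [p.HolderConjugate q]
    (hp : p ≠ ∞) {w : α → ℝ} (hwm : Measurable w) (hw : MemLp w q μ) {C : ℝ}
    (hC : 0 ≤ C)
    (H : ∀ f : α → ℝ, MemLp f p μ → ∫ z, f z * w z ∂μ ≤ C * (eLpNorm f p μ).toReal) :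
    eLpNorm w q μ ≤ ENNReal.ofReal C := by
  by_cases hq : q = ∞
  · subst hq
    have h := ENNReal.HolderConjugate.inv_add_inv_eq_one p ∞
    have hp1 : p = 1 := by simpa using h
    subst hp1
    exact eLpNorm_top_le_of_integral_mul_le hwm hw H
  · exact eLpNorm_le_of_integral_mul_le_of_ne_top hp hq hwm hw hC H

/-! ### Truncation of the density and the duality of `L^p` and `L^q`. -/

variable [IsFiniteMeasure μ] [Fact (1 ≤ p)] [Fact (1 ≤ q)] [p.HolderConjugate q]

/-- Multiplication by an indicator function on `L^p`. -/
noncomputable def Lp.mulIndicator (p : ℝ≥0∞) [Fact (1 ≤ p)] {A : Set α} (hA : MeasurableSet A) :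
    Lp ℝ p μ →L[ℝ] Lp ℝ p μ :=
  (ContinuousLinearMap.mul ℝ ℝ).holderL μ ∞ p p
    (indicatorConstLp ∞ hA (measure_ne_top μ A) (1 : ℝ))

theorem Lp.coeFn_mulIndicator {A : Set α} (hA : MeasurableSet A) (f : Lp ℝ p μ) :
    Lp.mulIndicator p hA f =ᵐ[μ] A.indicator f := by
  have h1 := (ContinuousLinearMap.mul ℝ ℝ).coeFn_holder (r := p)
    (indicatorConstLp ∞ hA (measure_ne_top μ A) (1 : ℝ)) f
  filter_upwards [h1, indicatorConstLp_coeFn (p := ∞) (hs := hA) (hμs := measure_ne_top μ A)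
    (c := (1 : ℝ))] with z hz hz'
  refine hz.trans ?_
  rw [hz']
  by_cases h : z ∈ A <;> simp [h]

theorem Lp.mulIndicator_indicatorConstLp {A s : Set α} (hA : MeasurableSet A)
    (hs : MeasurableSet s) :
    Lp.mulIndicator p hA (indicatorConstLp p hs (measure_ne_top μ s) (1 : ℝ)) =
      indicatorConstLp p (hs.inter hA) (measure_ne_top μ _) (1 : ℝ) := by
  refine Lp.ext ?_
  filter_upwards [Lp.coeFn_mulIndicator hA (indicatorConstLp p hs (measure_ne_top μ s) (1 : ℝ)),
    indicatorConstLp_coeFn (p := p) (hs := hs) (hμs := measure_ne_top μ s) (c := (1 : ℝ)),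
    indicatorConstLp_coeFn (p := p) (hs := hs.inter hA) (hμs := measure_ne_top μ _)
      (c := (1 : ℝ))] with z h1 h2 h3
  rw [h1, h3]
  by_cases hz : z ∈ A <;> by_cases hz' : z ∈ s <;> simp [h2, hz, hz']

theorem Lp.norm_mulIndicator_le {A : Set α} (hA : MeasurableSet A) (f : Lp ℝ p μ) :
    ‖Lp.mulIndicator p hA f‖ ≤ ‖f‖ := by
  refine Lp.norm_le_norm_of_ae_le ?_
  filter_upwards [Lp.coeFn_mulIndicator hA f] with z hz
  rw [hz]
  exact norm_indicator_le_norm_self _ _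

theorem lpPairing_mul_indicatorConstLp {s : Set α} (hs : MeasurableSet s) (u : Lp ℝ q μ) :
    (ContinuousLinearMap.mul ℝ ℝ).lpPairing μ p q
      (indicatorConstLp p hs (measure_ne_top μ s) (1 : ℝ)) u = ∫ z in s, u z ∂μ := by
  rw [lpPairing_mul_apply, ← integral_indicator hs]
  refine integral_congr_ae ?_
  filter_upwards [indicatorConstLp_coeFn (p := p) (hs := hs) (hμs := measure_ne_top μ s)
    (c := (1 : ℝ))] with z hz
  rw [hz]
  by_cases h : z ∈ s <;> simp [h]

/-- A function that represents a functional on `L^p` on indicator functions is in `L^q`. -/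
theorem memLp_of_dual_indicator (hp : p ≠ ∞) (φ : StrongDual ℝ (Lp ℝ p μ)) {u : α → ℝ}
    (hum : Measurable u)
    (h : ∀ (s : Set α) (hs : MeasurableSet s),
      φ (indicatorConstLp p hs (measure_ne_top μ s) (1 : ℝ)) = ∫ z in s, u z ∂μ) :
    MemLp u q μ := by
  -- The converse of Hölder needs a function already in `L^q`, so u is truncated. Each truncation
  -- represents φ composed with multiplication by an indicator, whence a bound by ‖φ‖ uniform in n;
  -- Fatou's lemma passes it to u.
  set A : ℕ → Set α := fun n => {z | |u z| ≤ n} with hA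
  have hAm : ∀ n, MeasurableSet (A n) := fun n => measurableSet_le hum.abs measurable_const
  set w : ℕ → α → ℝ := fun n => (A n).indicator u with hw
  have hwm : ∀ n, Measurable (w n) := fun n => hum.indicator (hAm n)
  have hwL : ∀ n, MemLp (w n) q μ := fun n => by
    refine MemLp.of_bound (hwm n).aestronglyMeasurable n (ae_of_all _ fun z => ?_)
    by_cases hz : z ∈ A n
    · simp only [hw, Set.indicator_of_mem hz]; exact hz
    · simp [hw, hz]
  have hbound : ∀ n, eLpNorm (w n) q μ ≤ ENNReal.ofReal ‖φ‖ := fun n => by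
    have hφ : φ.comp (Lp.mulIndicator p (hAm n)) =
        ((ContinuousLinearMap.mul ℝ ℝ).lpPairing μ p q).flip ((hwL n).toLp (w n)) := by
      refine Lp.dual_ext hp fun s hs => ?_
      rw [ContinuousLinearMap.comp_apply, Lp.mulIndicator_indicatorConstLp, h,
        ContinuousLinearMap.flip_apply, lpPairing_mul_indicatorConstLp,
        ← setIntegral_indicator (hAm n)]
      exact setIntegral_congr_ae hs ((hwL n).coeFn_toLp.mono fun z hz _ => hz.symm)
    refine eLpNorm_le_of_integral_mul_le hp (hwm n) (hwL n) (norm_nonneg _) fun f hf => ?_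
    have h1 : ∫ z, f z * w n z ∂μ = φ (Lp.mulIndicator p (hAm n) (hf.toLp f)) := by
      rw [← ContinuousLinearMap.comp_apply, hφ, ContinuousLinearMap.flip_apply,
        lpPairing_mul_apply]
      refine integral_congr_ae ?_
      filter_upwards [hf.coeFn_toLp, (hwL n).coeFn_toLp] with z h1 h2
      rw [h1, h2]
    rw [h1, ← Lp.norm_toLp f hf]
    refine (le_abs_self _).trans ((φ.le_opNorm _).trans ?_)
    exact mul_le_mul_of_nonneg_left (Lp.norm_mulIndicator_le _ _) (norm_nonneg _)
  refine ⟨hum.aestronglyMeasurable, ?_⟩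
  have hlim : ∀ᵐ z ∂μ, Tendsto (fun n => w n z) atTop (𝓝 (u z)) := ae_of_all _ fun z => by
    refine tendsto_const_nhds.congr' ?_
    filter_upwards [eventually_ge_atTop ⌈|u z|⌉₊] with n hn
    have : z ∈ A n := (Nat.ceil_le.1 hn)
    simp [hw, this]
  refine (Lp.eLpNorm_lim_le_liminf_eLpNorm (fun n => (hwm n).aestronglyMeasurable) u hlim).trans_lt
    (lt_of_le_of_lt ?_ (ENNReal.ofReal_lt_top (r := ‖φ‖)))
  exact (liminf_le_liminf (Eventually.of_forall hbound)).trans (by simp)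

/-- The pairing identifies `L^q` with the dual of `L^p`, `1 ≤ p < ∞`. -/
theorem bijective_lpPairing_mul_flip (hp : p ≠ ∞) :
    Function.Bijective ((ContinuousLinearMap.mul ℝ ℝ).lpPairing μ p q).flip := by
  constructor
  · rw [injective_iff_map_eq_zero]
    intro u hu
    have hq1 : 1 ≤ q := Fact.out
    have hui : Integrable u μ := (Lp.memLp u).integrable hq1
    refine (Lp.eq_zero_iff_ae_eq_zero).2 (hui.ae_eq_zero_of_forall_setIntegral_eq_zero
      fun s hs _ => ?_)
    rw [← lpPairing_mul_indicatorConstLp (p := p) hs u, ← ContinuousLinearMap.flip_apply, hu]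
    rfl
  · intro φ
    obtain ⟨u, hum, -, hu⟩ := Lp.exists_integrable_dual_indicator hp φ
    have huL : MemLp u q μ := memLp_of_dual_indicator hp φ hum hu
    refine ⟨huL.toLp u, Lp.dual_ext hp fun s hs => ?_⟩
    rw [ContinuousLinearMap.flip_apply, lpPairing_mul_indicatorConstLp, hu]
    exact setIntegral_congr_ae hs (huL.coeFn_toLp.mono fun z hz _ => hz)

end MeasureTheory

/-! ### Separability of a space with separable dual -/

/-- A normed space with separable dual is separable. -/
theorem NormedSpace.separableSpace_of_dual {E : Type*} [NormedAddCommGroup E] [NormedSpace ℝ E]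
    [TopologicalSpace.SeparableSpace (StrongDual ℝ E)] : TopologicalSpace.SeparableSpace E := by
  have hv : ∀ f : StrongDual ℝ E, ∃ v : E, ‖v‖ ≤ 1 ∧ ‖f‖ / 2 ≤ ‖f v‖ := fun f => by
    rcases eq_or_ne f 0 with rfl | hf
    · exact ⟨0, by simp, by simp⟩
    · obtain ⟨v, hv, h⟩ := f.exists_lt_apply_of_lt_opNorm (half_lt_self (norm_pos_iff.2 hf))
      exact ⟨v, hv.le, h.le⟩
  choose v hv1 hv2 using hv
  obtain ⟨D, hDc, hDd⟩ := TopologicalSpace.exists_countable_dense (StrongDual ℝ E)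
  -- If S were proper, some nonzero f would vanish on it. Take g in D within ‖f‖/4 of f: since g
  -- nearly attains half its norm at `v g`, where f vanishes, ‖g‖ ≤ 2‖g - f‖, and so ‖f‖ ≤ 3‖g - f‖
  -- < ‖f‖.
  set S : Submodule ℝ E := (Submodule.span ℝ (v '' D)).topologicalClosure with hS
  have hSsep : TopologicalSpace.IsSeparable (S : Set E) := by
    rw [hS, Submodule.topologicalClosure_coe]
    exact ((hDc.image v).isSeparable.span (R := ℝ)).closure
  have hvS : ∀ f ∈ D, v f ∈ S := fun f hf =>
    Submodule.le_topologicalClosure _ (Submodule.subset_span ⟨f, hf, rfl⟩)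
  have htop : (S : Set E) = Set.univ := by
    rw [Set.eq_univ_iff_forall]
    intro x
    by_contra hx
    have hScl : IsClosed (S : Set E) := Submodule.isClosed_topologicalClosure _
    obtain ⟨f, u, hfx, hfS⟩ := geometric_hahn_banach_point_closed S.convex hScl hx
    have hf0 : ∀ y ∈ S, f y = 0 := fun y hy => by
      by_contra hne
      -- The multiple of y on which f takes the value u - 1, below the separating level.
      have hu := hfS _ (S.smul_mem ((u - 1) / f y) hy)
      rw [map_smul, smul_eq_mul, div_mul_cancel₀ _ hne] at hu
      linarith
    have hu0 : u < 0 := by simpa using hfS 0 S.zero_mem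
    have hfne : f ≠ 0 := fun h => by rw [h] at hfx; simp at hfx; linarith
    have hpos : 0 < ‖f‖ / 4 := by have := norm_pos_iff.2 hfne; linarith
    obtain ⟨g, hgD, hg⟩ := Metric.dense_iff.1 hDd f _ hpos
    rw [Metric.mem_ball, dist_eq_norm] at hgD
    have h1 : ‖g (v g)‖ ≤ ‖g - f‖ := by
      have h2 : g (v g) = (g - f) (v g) := by
        rw [sub_apply, hf0 _ (hvS g hg), sub_zero]
      rw [h2]
      exact ((g - f).le_opNorm _).trans (mul_le_of_le_one_right (norm_nonneg _) (hv1 g))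
    have h3 : ‖f‖ ≤ ‖g‖ + ‖g - f‖ := by
      have := norm_sub_norm_le f g
      rw [norm_sub_rev] at this
      linarith
    linarith [hv2 g]
  rw [htop] at hSsep
  exact TopologicalSpace.isSeparable_univ_iff.1 hSsep

/-- The dual of a reflexive separable space is separable. -/
theorem NormedSpace.separableSpace_dual_of_reflexive {F : Type*} [NormedAddCommGroup F]
    [NormedSpace ℝ F] [TopologicalSpace.SeparableSpace F]
    (hrefl : Function.Surjective (NormedSpace.inclusionInDoubleDual ℝ F)) :
    TopologicalSpace.SeparableSpace (StrongDual ℝ F) := by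
  have : TopologicalSpace.SeparableSpace (StrongDual ℝ (StrongDual ℝ F)) :=
    hrefl.denseRange.separableSpace (NormedSpace.inclusionInDoubleDual ℝ F).continuous
  exact NormedSpace.separableSpace_of_dual

namespace SVR

open Filter Topology

/-! ### Affine minorants and conjugates -/

variable {E : Type*} [NormedAddCommGroup E] [NormedSpace ℝ E] {G : E → EReal}

theorem IsGammaZero.convex_epigraph (hG : IsGammaZero G) :
    Convex ℝ {x : E × ℝ | G x.1 ≤ (x.2 : EReal)} := by
  rw [convex_iff_forall_pos]
  rintro ⟨v, r⟩ hv ⟨w, r'⟩ hw s t hs ht hst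
  refine (hG.convex v w s t hs ht hst).trans ?_
  change _ ≤ ((s * r + t * r' : ℝ) : EReal)
  rw [EReal.coe_add, EReal.coe_mul, EReal.coe_mul]
  exact add_le_add (mul_le_mul_of_nonneg_left hv (EReal.coe_nonneg.2 hs.le))
    (mul_le_mul_of_nonneg_left hw (EReal.coe_nonneg.2 ht.le))

theorem IsGammaZero.isClosed_epigraph (hG : IsGammaZero G) :
    IsClosed {x : E × ℝ | G x.1 ≤ (x.2 : EReal)} :=
  hG.lsc.isClosed_epigraph.preimage
    (f := fun x : E × ℝ => (x.1, (x.2 : EReal)))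
    (continuous_fst.prodMk (continuous_coe_real_ereal.comp continuous_snd))

theorem IsGammaZero.exists_coe (hG : IsGammaZero G) : ∃ (w : E) (r : ℝ), G w = r := by
  obtain ⟨w, hw⟩ := hG.proper
  exact ⟨w, (G w).toReal, (EReal.coe_toReal hw (hG.ne_bot w)).symm⟩

/-- Separation of a point below the graph from the epigraph. -/
theorem IsGammaZero.exists_separation (hG : IsGammaZero G) {w : E} {a : ℝ}
    (ha : (a : EReal) < G w) :
    ∃ (ψ : StrongDual ℝ E) (k u : ℝ), 0 ≤ k ∧ ψ w + k * a < u ∧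
      ∀ (v : E) (r : ℝ), G v ≤ r → u < ψ v + k * r := by
  obtain ⟨f, u, h1, h2⟩ := geometric_hahn_banach_point_closed hG.convex_epigraph
    hG.isClosed_epigraph (x := (w, a)) (not_le.2 ha)
  have hf : ∀ (v : E) (r : ℝ), f (v, r) = f (v, 0) + f (0, 1) * r := fun v r => by
    rw [mul_comm, ← smul_eq_mul, ← map_smul, ← map_add]; simp
  have h2' : ∀ (v : E) (r : ℝ), G v ≤ r → u < f (v, 0) + f (0, 1) * r := fun v r hv => by
    rw [← hf]; exact h2 (v, r) hv
  refine ⟨f.comp (.inl ℝ E ℝ), f (0, 1), u, ?_, ?_, h2'⟩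
  · obtain ⟨v, r, hv⟩ := hG.exists_coe
    by_contra hk
    push Not at hk
    -- The epigraph is unbounded upwards: with a negative vertical slope, this height already brings
    -- the functional down to u.
    have h3 := h2' v (max r ((u - f (v, 0)) / f (0, 1)))
      (by rw [hv]; exact EReal.coe_le_coe_iff.2 (le_max_left _ _))
    have h4 := mul_le_mul_of_nonpos_left (le_max_right r ((u - f (v, 0)) / f (0, 1))) hk.le
    rw [mul_div_cancel₀ _ hk.ne] at h4
    linarith
  · rw [hf] at h1; exact h1

/-- A hyperplane with k > 0 is not vertical, so dividing by k makes it the graph of an affine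
minorant. Minorants are phrased through real upper bounds of G to avoid extended-real arithmetic. -/
theorem exists_minorant_of_separation {w : E} {a k u : ℝ}
    {ψ : StrongDual ℝ E} (hk : 0 < k) (hw : ψ w + k * a < u)
    (h : ∀ (v : E) (r : ℝ), G v ≤ r → u < ψ v + k * r) :
    ∃ (φ : StrongDual ℝ E) (c : ℝ),
      (∀ v (r : ℝ), G v ≤ r → φ v - c ≤ r) ∧ a < φ w - c := by
  refine ⟨-(k⁻¹ • ψ), -(k⁻¹ * u), fun v r hr => ?_, ?_⟩
  · have h1 := mul_le_mul_of_nonneg_left (h v r hr).le (inv_pos.2 hk).le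
    rw [mul_add, inv_mul_cancel_left₀ hk.ne'] at h1
    simp only [neg_apply, smul_apply, smul_eq_mul]
    linarith
  · have h1 := mul_lt_mul_of_pos_left hw (inv_pos.2 hk)
    rw [mul_add, inv_mul_cancel_left₀ hk.ne'] at h1
    simp only [neg_apply, smul_apply, smul_eq_mul]
    linarith

/-- Separating at a point w of the domain excludes a vertical hyperplane, since w would have to lie
strictly on both sides of it. -/
theorem IsGammaZero.exists_minorant (hG : IsGammaZero G) :
    ∃ (φ : StrongDual ℝ E) (c : ℝ), ∀ v (r : ℝ), G v ≤ r → φ v - c ≤ r := by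
  obtain ⟨w, r, hw⟩ := hG.exists_coe
  obtain ⟨ψ, k, u, hk, h1, h2⟩ := hG.exists_separation (w := w) (a := r - 1)
    (by rw [hw]; exact EReal.coe_lt_coe_iff.2 (by linarith))
  have hk' : 0 < k := by
    refine hk.lt_of_ne fun h0 => ?_
    have := h2 w r hw.le
    rw [← h0] at this h1
    linarith
  obtain ⟨φ, c, h, -⟩ := exists_minorant_of_separation hk' h1 h2
  exact ⟨φ, c, h⟩

/-- A proper convex lower semicontinuous function is the supremum of its affine minorants. -/
theorem IsGammaZero.exists_minorant_gt (hG : IsGammaZero G) {w : E} {a : ℝ}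
    (ha : (a : EReal) < G w) :
    ∃ (φ : StrongDual ℝ E) (c : ℝ), (∀ v (r : ℝ), G v ≤ r → φ v - c ≤ r) ∧ a < φ w - c := by
  obtain ⟨ψ, k, u, hk, h1, h2⟩ := hG.exists_separation ha
  rcases hk.eq_or_lt with rfl | hk
  · obtain ⟨φ, c, hφ⟩ := hG.exists_minorant
    simp only [zero_mul, add_zero] at h1 h2
    -- Vertical case: u - ψ is negative on the domain of G and positive at w. Adding a large
    -- multiple of it to any affine minorant keeps a minorant and lifts its value at w above a.
    obtain ⟨t, ht⟩ := exists_nat_gt ((a - (φ w - c)) / (u - ψ w))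
    rw [div_lt_iff₀ (by linarith)] at ht
    refine ⟨φ - (t : ℝ) • ψ, c - t * u, fun v r hr => ?_, ?_⟩
    · have h3 := mul_le_mul_of_nonneg_left (h2 v r hr).le (Nat.cast_nonneg (α := ℝ) t)
      have h4 := hφ v r hr
      simp only [sub_apply, smul_apply, smul_eq_mul]
      linarith
    · simp only [sub_apply, smul_apply, smul_eq_mul]
      linarith
  · exact exists_minorant_of_separation hk h1 h2

theorem fenchelConj_le_coe {φ : StrongDual ℝ E} {c : ℝ} (hG : ∀ w, G w ≠ ⊥)
    (h : ∀ v (r : ℝ), G v ≤ r → φ v - c ≤ r) : fenchelConj G φ ≤ c := by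
  refine iSup_le fun v => ?_
  by_cases hv : G v = ⊤
  · rw [hv]; simp
  · have h1 := EReal.coe_toReal hv (hG v)
    rw [← h1, ← EReal.coe_sub, EReal.coe_le_coe_iff]
    linarith [h v _ h1.ge]

theorem fenchelConj_ne_bot (hG : ∃ w, G w ≠ ⊤) (φ : StrongDual ℝ E) : fenchelConj G φ ≠ ⊥ := by
  obtain ⟨w, hw⟩ := hG
  intro h
  have h1 : ((φ w : ℝ) : EReal) - G w ≤ ⊥ := h ▸ le_iSup (fun w => ((φ w : ℝ) : EReal) - G w) w
  rw [le_bot_iff, sub_eq_add_neg, EReal.add_eq_bot_iff] at h1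
  rcases h1 with h1 | h1
  · exact EReal.coe_ne_bot _ h1
  · exact hw (EReal.neg_eq_bot_iff.1 h1)

theorem IsGammaZero.exists_fenchelConj_coe (hG : IsGammaZero G) :
    ∃ (φ : StrongDual ℝ E) (c : ℝ), fenchelConj G φ = c := by
  obtain ⟨φ, c, h⟩ := hG.exists_minorant
  have h1 := fenchelConj_le_coe hG.ne_bot h
  exact ⟨φ, _, (EReal.coe_toReal (ne_top_of_le_ne_top (EReal.coe_ne_top c) h1)
    (fenchelConj_ne_bot hG.proper φ)).symm⟩

theorem apply_le_of_fenchelConj_le {φ : StrongDual ℝ E} {w : E} {c r : ℝ}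
    (h : fenchelConj G φ ≤ c) (hw : G w ≤ r) : φ w ≤ r + c := by
  have h1 : ((φ w : ℝ) : EReal) - G w ≤ c :=
    (le_iSup (fun w => ((φ w : ℝ) : EReal) - G w) w).trans h
  have h2 : ((φ w - r : ℝ) : EReal) ≤ c := by
    rw [EReal.coe_sub]
    exact (EReal.sub_le_sub le_rfl hw).trans h1
  linarith [EReal.coe_le_coe_iff.1 h2]

/-- For `G` in `Γ₀`, membership of `w` in `∂G*(φ)` is equality in the Fenchel–Young inequality. -/
theorem IsGammaZero.mem_subdifferential_fenchelConj_iff (hG : IsGammaZero G) {w : E}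
    {φ : StrongDual ℝ E} :
    NormedSpace.inclusionInDoubleDual ℝ E w ∈ subdifferential (fenchelConj G) φ ↔
      ∃ r c : ℝ, G w = r ∧ fenchelConj G φ = c ∧ r + c = φ w := by
  constructor
  · intro h
    have h' : ∀ ψ : StrongDual ℝ E,
        fenchelConj G φ + ((ψ w - φ w : ℝ) : EReal) ≤ fenchelConj G ψ := fun ψ => h ψ
    obtain ⟨φ₀, c₀, h0⟩ := hG.exists_fenchelConj_coe
    have hne : fenchelConj G φ ≠ ⊤ := fun ht => by
      have h1 := h' φ₀
      rw [ht, h0, EReal.top_add_coe, top_le_iff] at h1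
      exact EReal.coe_ne_top _ h1
    obtain ⟨c, hc⟩ : ∃ c : ℝ, fenchelConj G φ = c :=
      ⟨_, (EReal.coe_toReal hne (fenchelConj_ne_bot hG.proper φ)).symm⟩
    have hle : G w ≤ ((φ w - c : ℝ) : EReal) := by
      by_contra hcon
      -- A minorant (ψ, d) with ψ w - d > φ w - c has G*(ψ) ≤ d, which violates the subgradient
      -- inequality at ψ. This plays the role of G** = G.
      obtain ⟨ψ, d, h1, h2⟩ := hG.exists_minorant_gt (not_le.1 hcon)
      have h3 := (h' ψ).trans (fenchelConj_le_coe hG.ne_bot h1)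
      rw [hc, ← EReal.coe_add, EReal.coe_le_coe_iff] at h3
      linarith
    obtain ⟨r, hr⟩ : ∃ r : ℝ, G w = r :=
      ⟨_, (EReal.coe_toReal (ne_top_of_le_ne_top (EReal.coe_ne_top _) hle) (hG.ne_bot w)).symm⟩
    refine ⟨r, c, hr, hc, le_antisymm ?_ ?_⟩
    · rw [hr, EReal.coe_le_coe_iff] at hle
      linarith
    · exact apply_le_of_fenchelConj_le hc.le hr.le
  · rintro ⟨r, c, hr, hc, hrc⟩ ψ
    change fenchelConj G φ + ((ψ w - φ w : ℝ) : EReal) ≤ fenchelConj G ψ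
    refine le_trans (le_of_eq ?_) (le_iSup (fun w => ((ψ w : ℝ) : EReal) - G w) w)
    simp only [hc, hr]
    rw [← EReal.coe_add, ← EReal.coe_sub]
    congr 1
    linarith

/-! ### Integrals of extended-real functions -/

section ExtIntegral

variable {Ω : Type*} [MeasurableSpace Ω] {μ : Measure Ω}

theorem extIntegral_mono_ae {f g : Ω → EReal} (h : f ≤ᵐ[μ] g) :
    extIntegral μ f ≤ extIntegral μ g := by
  refine EReal.sub_le_sub ?_ ?_
  · exact EReal.coe_ennreal_le_coe_ennreal_iff.2
      (lintegral_mono_ae (h.mono fun z hz => EReal.toENNReal_le_toENNReal hz))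
  · exact EReal.coe_ennreal_le_coe_ennreal_iff.2
      (lintegral_mono_ae (h.mono fun z hz =>
        EReal.toENNReal_le_toENNReal (EReal.neg_le_neg_iff.2 hz)))

theorem extIntegral_congr_ae {f g : Ω → EReal} (h : f =ᵐ[μ] g) :
    extIntegral μ f = extIntegral μ g :=
  le_antisymm (extIntegral_mono_ae h.le) (extIntegral_mono_ae h.symm.le)

theorem extIntegral_coe {f : Ω → ℝ} (hf : Integrable f μ) :
    extIntegral μ (fun z => (f z : EReal)) = ((∫ z, f z ∂μ : ℝ) : EReal) := by
  rw [integral_eq_lintegral_pos_part_sub_lintegral_neg_part hf, EReal.coe_sub]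
  unfold extIntegral
  have h1 : ∫⁻ z, ENNReal.ofReal (f z) ∂μ ≠ ∞ := hf.lintegral_lt_top.ne
  have h2 : ∫⁻ z, ENNReal.ofReal (-f z) ∂μ ≠ ∞ := hf.neg.lintegral_lt_top.ne
  rw [EReal.coe_ennreal_toReal h1, EReal.coe_ennreal_toReal h2]
  simp only [← EReal.coe_neg, EReal.toENNReal_of_ne_top (EReal.coe_ne_top _), EReal.toReal_coe]

theorem enorm_toReal_le (x : EReal) : ‖x.toReal‖ₑ ≤ x.toENNReal + (-x).toENNReal := by
  induction x with
  | bot => simp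
  | top => simp
  | coe r =>
    simp only [← EReal.coe_neg, EReal.toENNReal_of_ne_top (EReal.coe_ne_top _), EReal.toReal_coe]
    rcases le_total 0 r with hr | hr
    · rw [Real.enorm_eq_ofReal hr]; exact le_self_add
    · rw [← enorm_neg, Real.enorm_eq_ofReal (neg_nonneg.2 hr)]; exact le_add_self

/-- A function with integral less than `+∞` and integrable negative part agrees almost everywhere
with an integrable real function. -/
theorem exists_integrable_of_extIntegral_ne_top {f : Ω → EReal} (hf : AEMeasurable f μ)
    (hneg : ∫⁻ z, (-f z).toENNReal ∂μ ≠ ∞) (h : extIntegral μ f ≠ ⊤) :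
    ∃ g : Ω → ℝ, Integrable g μ ∧ f =ᵐ[μ] fun z => (g z : EReal) := by
  have hpos : ∫⁻ z, (f z).toENNReal ∂μ ≠ ∞ := fun ht => by
    apply h
    unfold extIntegral
    rw [ht, ← EReal.coe_ennreal_toReal hneg, EReal.coe_ennreal_top, EReal.top_sub_coe]
  have hm1 : AEMeasurable (fun z => (f z).toENNReal) μ :=
    measurable_ereal_toENNReal.comp_aemeasurable hf
  have hm2 : AEMeasurable (fun z => (-f z).toENNReal) μ :=
    measurable_ereal_toENNReal.comp_aemeasurable hf.neg
  have hae : f =ᵐ[μ] fun z => (((f z).toReal : ℝ) : EReal) := by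
    filter_upwards [ae_lt_top' hm1 hpos, ae_lt_top' hm2 hneg] with z h1 h2
    refine (EReal.coe_toReal ?_ ?_).symm
    · intro ht; simp [ht] at h1
    · intro ht; simp [ht] at h2
  refine ⟨fun z => (f z).toReal, ⟨hf.ereal_toReal.aestronglyMeasurable, ?_⟩, hae⟩
  exact (lintegral_mono fun z => enorm_toReal_le (f z)).trans_lt
    ((lintegral_add_left' hm1 _).trans_lt (ENNReal.add_lt_top.2 ⟨hpos.lt_top, hneg.lt_top⟩))

/-- Monotone convergence for an increasing sequence of integrable functions with bounded
integrals. -/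
theorem extIntegral_iSup_le {f : ℕ → Ω → ℝ} (hmono : ∀ z, Monotone fun n => f n z)
    (hf : ∀ n, Integrable (f n) μ) {r : ℝ} (hr : ∀ n, ∫ z, f n z ∂μ ≤ r) :
    extIntegral μ (fun z => ⨆ n, (f n z : EReal)) ≤ r := by
  -- Subtracting the integrable first term makes the sequence nonnegative; monotone convergence then
  -- bounds the supremum and shows it finite almost everywhere.
  have hnn : ∀ n z, 0 ≤ f n z - f 0 z := fun n z => sub_nonneg.2 (hmono z (Nat.zero_le n))
  have hm : ∀ n, AEMeasurable (fun z => ENNReal.ofReal (f n z - f 0 z)) μ := fun n =>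
    ((hf n).sub (hf 0)).aemeasurable.ennreal_ofReal
  have hfin : ∫⁻ z, ⨆ n, ENNReal.ofReal (f n z - f 0 z) ∂μ ≤
      ENNReal.ofReal (r - ∫ z, f 0 z ∂μ) := by
    rw [lintegral_iSup' hm (ae_of_all _ fun z m n hmn =>
      ENNReal.ofReal_le_ofReal (sub_le_sub_right (hmono z hmn) _))]
    refine iSup_le fun n => ?_
    rw [← ofReal_integral_eq_lintegral_ofReal (f := fun z => f n z - f 0 z)
      ((hf n).sub (hf 0)) (ae_of_all _ (hnn n)), integral_sub (hf n) (hf 0)]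
    exact ENNReal.ofReal_le_ofReal (sub_le_sub_right (hr n) _)
  have hbdd : ∀ᵐ z ∂μ, BddAbove (Set.range fun n => f n z) := by
    filter_upwards [ae_lt_top' (AEMeasurable.iSup hm)
      (hfin.trans_lt ENNReal.ofReal_lt_top).ne] with z hz
    refine ⟨(⨆ n, ENNReal.ofReal (f n z - f 0 z)).toReal + f 0 z, ?_⟩
    rintro _ ⟨n, rfl⟩
    have h1 : ENNReal.ofReal (f n z - f 0 z) ≤ ⨆ n, ENNReal.ofReal (f n z - f 0 z) :=
      le_iSup (fun n => ENNReal.ofReal (f n z - f 0 z)) n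
    have h2 := (ENNReal.ofReal_le_iff_le_toReal hz.ne).1 h1
    simp only
    linarith
  set g : Ω → ℝ := fun z => ⨆ n, f n z with hg
  have hlim : ∀ᵐ z ∂μ, Tendsto (fun n => f n z) atTop (𝓝 (g z)) := by
    filter_upwards [hbdd] with z hz using tendsto_atTop_ciSup (hmono z) hz
  have hgm : AEMeasurable g μ := 
    aemeasurable_of_tendsto_metrizable_ae' (fun n => (hf n).aemeasurable) hlim
  have hg0 : 0 ≤ᵐ[μ] fun z => g z - f 0 z := by
    filter_upwards [hbdd] with z hz using sub_nonneg.2 (le_ciSup hz 0)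
  have hle : ∫⁻ z, ENNReal.ofReal (g z - f 0 z) ∂μ ≤ ENNReal.ofReal (r - ∫ z, f 0 z ∂μ) := by
    refine le_trans (lintegral_mono_ae ?_) hfin
    filter_upwards [hlim] with z hz
    refine le_of_tendsto ((ENNReal.continuous_ofReal.tendsto _).comp
      (hz.sub_const (f 0 z))) (Eventually.of_forall fun n => ?_)
    exact le_iSup (fun n => ENNReal.ofReal (f n z - f 0 z)) n
  have hgi' : Integrable (fun z => g z - f 0 z) μ := by
    refine ⟨(hgm.sub (hf 0).aemeasurable).aestronglyMeasurable, ?_⟩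
    rw [hasFiniteIntegral_iff_ofReal hg0]
    exact hle.trans_lt ENNReal.ofReal_lt_top
  have hgi : Integrable g μ := (hgi'.add (hf 0)).congr (ae_of_all _ fun z => by simp)
  have hcoe : (fun z => ⨆ n, (f n z : EReal)) =ᵐ[μ] fun z => (g z : EReal) := by
    filter_upwards [hlim] with z hz
    exact tendsto_nhds_unique
      (tendsto_atTop_iSup fun m n hmn => EReal.coe_le_coe_iff.2 (hmono z hmn))
      ((continuous_coe_real_ereal.tendsto _).comp hz)
  rw [extIntegral_congr_ae hcoe, extIntegral_coe hgi, EReal.coe_le_coe_iff]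
  rw [← ofReal_integral_eq_lintegral_ofReal hgi' hg0, integral_sub hgi (hf 0),
    ENNReal.ofReal_le_ofReal_iff (sub_nonneg.2 (hr 0))] at hle
  linarith

end ExtIntegral

/-! ### Conjugate of a finite convex function on the line -/

section RealConj

variable {L : ℝ → ℝ}

theorem coe_le_realConj (L : ℝ → ℝ) (s t : ℝ) : ((s * t - L t : ℝ) : EReal) ≤ realConj L s :=
  le_iSup (fun t => ((s * t - L t : ℝ) : EReal)) t

theorem neg_realConj_le (L : ℝ → ℝ) (s : ℝ) : -realConj L s ≤ ((L 0 : ℝ) : EReal) := by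
  rw [EReal.neg_le, ← EReal.coe_neg]
  simpa using coe_le_realConj L s 0

theorem mem_realSubdifferential_iff {s t : ℝ} :
    s ∈ realSubdifferential L t ↔ realConj L s = ((s * t - L t : ℝ) : EReal) := by
  constructor
  · intro h
    refine le_antisymm (iSup_le fun v => EReal.coe_le_coe_iff.2 ?_) (coe_le_realConj L s t)
    have := h v
    rw [mul_sub] at this
    linarith
  · intro h v
    have h1 := coe_le_realConj L s v
    rw [h, EReal.coe_le_coe_iff] at h1
    rw [mul_sub]
    linarith

/-- Successive near-maximizers of `t ↦ s t - L t` along a dense sequence. -/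
noncomputable def conjSelector (L : ℝ → ℝ) : ℕ → ℝ → ℝ
  | 0, _ => 0
  | n + 1, s =>
    if s * conjSelector L n s - L (conjSelector L n s) <
        s * TopologicalSpace.denseSeq ℝ n - L (TopologicalSpace.denseSeq ℝ n) then
      TopologicalSpace.denseSeq ℝ n
    else conjSelector L n s

theorem measurable_conjSelector (hL : Continuous L) (n : ℕ) : Measurable (conjSelector L n) := by
  induction n with
  | zero => exact measurable_const
  | succ n ih =>
    refine Measurable.ite (measurableSet_lt ?_ ?_) measurable_const ih
    · exact (measurable_id.mul ih).sub (hL.measurable.comp ih)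
    · exact (measurable_id.mul_const _).sub_const _

/-- Stage n only chooses among finitely many values. Boundedness makes the selection a legitimate
test function in every `L^p` of a finite measure. -/
theorem exists_abs_conjSelector_le (L : ℝ → ℝ) (n : ℕ) : ∃ C, ∀ s, |conjSelector L n s| ≤ C := by
  induction n with
  | zero => exact ⟨0, fun s => by simp [conjSelector]⟩
  | succ n ih =>
    obtain ⟨C, hC⟩ := ih
    refine ⟨max C |TopologicalSpace.denseSeq ℝ n|, fun s => ?_⟩
    rw [conjSelector]
    split_ifs
    · exact le_max_right _ _
    · exact (hC s).trans (le_max_left _ _)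

/-- The values `s t - L t` at the near-maximizers. -/
noncomputable def conjApprox (L : ℝ → ℝ) (n : ℕ) (s : ℝ) : ℝ :=
  s * conjSelector L n s - L (conjSelector L n s)

theorem conjApprox_mono (L : ℝ → ℝ) (s : ℝ) : Monotone fun n => conjApprox L n s := by
  refine monotone_nat_of_le_succ fun n => ?_
  simp only [conjApprox, conjSelector]
  split_ifs with h
  · exact h.le
  · exact le_rfl

theorem le_conjApprox_succ (L : ℝ → ℝ) (n : ℕ) (s : ℝ) :
    s * TopologicalSpace.denseSeq ℝ n - L (TopologicalSpace.denseSeq ℝ n) ≤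
      conjApprox L (n + 1) s := by
  simp only [conjApprox, conjSelector]
  split_ifs with h
  · exact le_rfl
  · exact not_lt.1 h

theorem measurable_conjApprox (hL : Continuous L) (n : ℕ) : Measurable (conjApprox L n) :=
  (measurable_id.mul (measurable_conjSelector hL n)).sub
    (hL.measurable.comp (measurable_conjSelector hL n))

/-- By continuity of L, the supremum over ℝ is one over a dense sequence. Thus L* is a countable
increasing supremum of measurable functions. -/
theorem realConj_eq_iSup_conjApprox (hL : Continuous L) (s : ℝ) :
    realConj L s = ⨆ n, (conjApprox L n s : EReal) := by
  refine le_antisymm (iSup_le fun t => ?_) (iSup_le fun n => coe_le_realConj L s _)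
  have hcl : IsClosed {t : ℝ | ((s * t - L t : ℝ) : EReal) ≤ ⨆ n, (conjApprox L n s : EReal)} :=
    isClosed_le (continuous_coe_real_ereal.comp ((continuous_const.mul continuous_id).sub hL))
      continuous_const
  refine (TopologicalSpace.denseRange_denseSeq ℝ).induction_on
    (p := fun t => ((s * t - L t : ℝ) : EReal) ≤ ⨆ n, (conjApprox L n s : EReal)) t hcl
    fun n => ?_
  exact (EReal.coe_le_coe_iff.2 (le_conjApprox_succ L n s)).trans
    (le_iSup (fun n => (conjApprox L n s : EReal)) (n + 1))

theorem measurable_realConj (hL : Continuous L) : Measurable (realConj L) := by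
  have h : realConj L = fun s => ⨆ n, (conjApprox L n s : EReal) :=
    funext (realConj_eq_iSup_conjApprox hL)
  rw [h]
  exact Measurable.iSup fun n => (measurable_conjApprox hL n).coe_real_ereal

end RealConj

/-! ### Integral functionals -/

section IntegralFunctional

variable {Ω : Type*} [MeasurableSpace Ω] {μ : Measure Ω} {L : ℝ → ℝ}
  {p : ℝ≥0∞}

theorem integral_le_extIntegral_realConj {s e : Ω → ℝ}
    (h : Integrable (fun z => s z * e z - L (e z)) μ) :
    ((∫ z, (s z * e z - L (e z)) ∂μ : ℝ) : EReal) ≤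
      extIntegral μ (fun z => realConj L (s z)) := by
  rw [← extIntegral_coe h]
  exact extIntegral_mono_ae (ae_of_all μ fun z => coe_le_realConj L (s z) (e z))

theorem convexOn_integral_comp (hL : ConvexOn ℝ Set.univ L)
    (hi : ∀ e : Lp ℝ p μ, Integrable (fun z => L (e z)) μ) :
    ConvexOn ℝ Set.univ fun e : Lp ℝ p μ => ∫ z, L (e z) ∂μ := by
  refine ⟨convex_univ, fun f _ g _ s t hs ht hst => ?_⟩
  simp only [smul_eq_mul]
  rw [← integral_const_mul, ← integral_const_mul,
    ← integral_add ((hi f).const_mul s) ((hi g).const_mul t)]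
  refine integral_mono_ae (hi _) (((hi f).const_mul s).add ((hi g).const_mul t)) ?_
  filter_upwards [Lp.coeFn_add (s • f) (t • g), Lp.coeFn_smul s f, Lp.coeFn_smul t g]
    with z h1 h2 h3
  simp only [h1, Pi.add_apply, h2, h3, Pi.smul_apply, smul_eq_mul]
  exact hL.2 (Set.mem_univ _) (Set.mem_univ _) hs ht hst

variable [IsFiniteMeasure μ]

/-- L* is bounded below by -L(0), a constant, and the measure is finite. -/
theorem lintegral_neg_realConj_ne_top (L : ℝ → ℝ) (s : Ω → ℝ) :
    ∫⁻ z, (-realConj L (s z)).toENNReal ∂μ ≠ ∞ := by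
  refine ne_top_of_le_ne_top ?_ (lintegral_mono fun z =>
    EReal.toENNReal_le_toENNReal (neg_realConj_le L (s z)))
  rw [lintegral_const]
  refine ENNReal.mul_ne_top ?_ (measure_ne_top μ _)
  simp

theorem extIntegral_realConj_ne_bot (L : ℝ → ℝ) (s : Ω → ℝ) :
    extIntegral μ (fun z => realConj L (s z)) ≠ ⊥ := by
  have h := extIntegral_mono_ae (μ := μ) (ae_of_all μ fun z => coe_le_realConj L (s z) 0)
  simp only [mul_zero, zero_sub] at h
  rw [extIntegral_coe (f := fun _ => -L 0) (integrable_const _)] at h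
  exact ne_bot_of_le_ne_bot (EReal.coe_ne_bot _) h

/-- If `∫ (s e - L(e))` is at most `r` for all bounded `e`, then `∫ L*(s)` is at most `r`. -/
theorem extIntegral_realConj_le (hL : Continuous L) {s : Ω → ℝ} (hsm : Measurable s)
    (hs : Integrable s μ) {r : ℝ}
    (h : ∀ e : Ω → ℝ, Measurable e → (∃ C, ∀ z, ‖e z‖ ≤ C) →
      ∫ z, (s z * e z - L (e z)) ∂μ ≤ r) :
    extIntegral μ (fun z => realConj L (s z)) ≤ r := by
  simp_rw [realConj_eq_iSup_conjApprox hL]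
  refine extIntegral_iSup_le (fun z => conjApprox_mono L (s z)) (fun n => ?_) fun n => ?_
  · obtain ⟨C, hC⟩ := exists_abs_conjSelector_le L n
    have hem := (measurable_conjSelector hL n).comp hsm
    refine Integrable.sub ?_ ?_
    · exact hs.mul_bdd (c := C) hem.aestronglyMeasurable (ae_of_all _ fun z => hC _)
    · obtain ⟨M, hM⟩ := (isCompact_Icc (a := -C) (b := C)).exists_bound_of_continuousOn
        hL.continuousOn
      exact Integrable.of_bound (hL.measurable.comp hem).aestronglyMeasurable M
        (ae_of_all _ fun z => hM _ (abs_le.1 (hC _)))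
  · obtain ⟨C, hC⟩ := exists_abs_conjSelector_le L n
    exact h _ ((measurable_conjSelector hL n).comp hsm) ⟨C, fun z => hC _⟩

/-- Equality in the integrated Fenchel–Young inequality. -/
theorem ae_mem_realSubdifferential_iff (hL : Continuous L) {s e : Ω → ℝ} (hsm : AEMeasurable s μ)
    (hse : Integrable (fun z => s z * e z) μ) (hLe : Integrable (fun z => L (e z)) μ) :
    (∀ᵐ z ∂μ, s z ∈ realSubdifferential L (e z)) ↔
      extIntegral μ (fun z => realConj L (s z)) =
        ((∫ z, s z * e z ∂μ - ∫ z, L (e z) ∂μ : ℝ) : EReal) := by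
  rw [← integral_sub hse hLe]
  constructor
  · intro h
    rw [← extIntegral_coe (f := fun z => s z * e z - L (e z)) (hse.sub hLe)]
    exact extIntegral_congr_ae (h.mono fun z hz => mem_realSubdifferential_iff.1 hz)
  · intro h
    -- A finite integral makes L*(s) real almost everywhere. The pointwise Fenchel–Young gap is then
    -- nonnegative with zero integral, so it vanishes almost everywhere.
    obtain ⟨g, hg, hge⟩ := exists_integrable_of_extIntegral_ne_top
      (f := fun z => realConj L (s z)) ((measurable_realConj hL).comp_aemeasurable hsm) (lintegral_neg_realConj_ne_top L s)
      (by rw [h]; exact EReal.coe_ne_top _)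
    have hle : 0 ≤ᵐ[μ] fun z => g z - (s z * e z - L (e z)) := by
      filter_upwards [hge] with z hz
      have h1 := coe_le_realConj L (s z) (e z)
      rw [hz, EReal.coe_le_coe_iff] at h1
      exact sub_nonneg.2 h1
    have h0 : ∫ z, (g z - (s z * e z - L (e z))) ∂μ = 0 := by
      rw [extIntegral_congr_ae hge, extIntegral_coe hg, EReal.coe_eq_coe_iff] at h
      rw [integral_sub (g := fun z => s z * e z - L (e z)) hg (hse.sub hLe), h, sub_self]
    filter_upwards [(integral_eq_zero_iff_of_nonneg_ae hle (hg.sub (hse.sub hLe))).1 h0, hge]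
      with z hz hz'
    rw [mem_realSubdifferential_iff, hz', EReal.coe_eq_coe_iff]
    exact sub_eq_zero.1 hz

theorem integrable_comp_of_growth [Fact (1 ≤ p)] (hp : p ≠ ∞) (hL0 : ∀ t, 0 ≤ L t)
    (hL : Continuous L) {a b : ℝ} (hab : ∀ t : ℝ, L t ≤ a + b * |t| ^ p.toReal) {e : Ω → ℝ}
    (he : MemLp e p μ) : Integrable (fun z => L (e z)) μ := by
  have hp0 : p ≠ 0 := (zero_lt_one.trans_le (Fact.out : 1 ≤ p)).ne'
  refine Integrable.mono' ((integrable_const a).add ((he.integrable_norm_rpow hp0 hp).const_mul b))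
    (hL.comp_aestronglyMeasurable he.1) (ae_of_all _ fun z => ?_)
  rw [Real.norm_of_nonneg (hL0 _)]
  exact hab (e z)

variable [Fact (1 ≤ p)]

theorem integral_comp_le_of_growth (hp : p ≠ ∞)
    (hi : ∀ e : Lp ℝ p μ, Integrable (fun z => L (e z)) μ)
    {a b : ℝ} (hab : ∀ t : ℝ, L t ≤ a + b * |t| ^ p.toReal) (e : Lp ℝ p μ) :
    ∫ z, L (e z) ∂μ ≤ a * μ.real Set.univ + b * ‖e‖ ^ p.toReal := by
  have hp0 : p ≠ 0 := (zero_lt_one.trans_le (Fact.out : 1 ≤ p)).ne'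
  have hI := (Lp.memLp e).integrable_norm_rpow hp0 hp
  have h1 : ‖e‖ ^ p.toReal = ∫ z, ‖e z‖ ^ p.toReal ∂μ := by
    have h0 : 0 ≤ ∫ z, ‖e z‖ ^ p.toReal ∂μ := integral_nonneg fun z => by positivity
    rw [Lp.norm_def, (Lp.memLp e).eLpNorm_eq_integral_rpow_norm hp0 hp,
      ENNReal.toReal_ofReal (by positivity), Real.rpow_inv_rpow h0 (ENNReal.toReal_pos hp0 hp).ne']
  have h2 : a * μ.real Set.univ = ∫ _, a ∂μ := by rw [integral_const, smul_eq_mul, mul_comm]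
  rw [h1, h2, ← integral_const_mul, ← integral_add (integrable_const _) (hI.const_mul b)]
  exact integral_mono (hi e) ((integrable_const _).add (hI.const_mul b)) fun z => hab (e z)

/-- A convex function bounded above near one point of an open convex set is continuous there. The
growth bound on L gives such a bound on the unit ball of `L^p`. -/
theorem continuous_integral_comp (hp : p ≠ ∞) (hL : ConvexOn ℝ Set.univ L)
    (hi : ∀ e : Lp ℝ p μ, Integrable (fun z => L (e z)) μ)
    {a b : ℝ} (hb : 0 ≤ b) (hab : ∀ t : ℝ, L t ≤ a + b * |t| ^ p.toReal) :
    Continuous fun e : Lp ℝ p μ => ∫ z, L (e z) ∂μ := by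
  rw [← continuousOn_univ]
  have htfae := (convexOn_integral_comp hL hi).continuousOn_tfae isOpen_univ Set.univ_nonempty
  have hiff := htfae.out 1 3
  refine hiff.2 ⟨0, Set.mem_univ _, a * μ.real Set.univ + b * 1 ^ p.toReal, ?_⟩
  rw [eventually_map]
  filter_upwards [Metric.ball_mem_nhds (0 : Lp ℝ p μ) zero_lt_one] with e he
  refine (integral_comp_le_of_growth hp hi hab e).trans ?_
  gcongr
  exact (mem_ball_zero_iff.1 he).le

end IntegralFunctional

/-! ### Extended-real bookkeeping -/

/-- An extended real is determined by its real upper bounds. Objectives are compared in this way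
below, so that infinite values need no separate treatment. -/
theorem le_of_forall_le_coe {x y : EReal} (h : ∀ r : ℝ, x ≤ r → y ≤ r) : y ≤ x := by
  induction x with
  | top => exact le_top
  | coe r => exact h r le_rfl
  | bot =>
    refine le_of_eq ((EReal.eq_bot_iff_forall_lt y).2 fun r => ?_)
    exact (h (r - 1) bot_le).trans_lt (EReal.coe_lt_coe_iff.2 (by linarith))

theorem eq_of_forall_le_coe_iff {x y : EReal} (h : ∀ r : ℝ, x ≤ r ↔ y ≤ r) : x = y :=
  le_antisymm (le_of_forall_le_coe fun r => (h r).2) (le_of_forall_le_coe fun r => (h r).1)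

theorem coe_add_le_coe_iff {a r : ℝ} {x : EReal} :
    (a : EReal) + x ≤ r ↔ x ≤ ((r - a : ℝ) : EReal) := by
  induction x with
  | top => rw [EReal.coe_add_top, top_le_iff, top_le_iff]; simp only [EReal.coe_ne_top]
  | bot => simp
  | coe x =>
    rw [← EReal.coe_add, EReal.coe_le_coe_iff, EReal.coe_le_coe_iff]
    constructor <;> intro h <;> linarith

theorem convexIndicator_of_mem {E : Type*} {C : Set E} {x : E} (h : x ∈ C) :
    convexIndicator C x = 0 := by
  simp [convexIndicator, h]

theorem convexIndicator_of_notMem {E : Type*} {C : Set E} {x : E} (h : x ∉ C) :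
    convexIndicator C x = ⊤ := by
  simp [convexIndicator, h]

theorem fenchelConj_le_coe_iff {E : Type*} [NormedAddCommGroup E] [NormedSpace ℝ E] {f : E → EReal}
    (hf : ∀ w, f w ≠ ⊥) {φ : StrongDual ℝ E} {c : ℝ} :
    fenchelConj f φ ≤ c ↔ ∀ v (r : ℝ), f v ≤ r → φ v - c ≤ r :=
  ⟨fun h v r hv => by linarith [apply_le_of_fenchelConj_le h hv], fenchelConj_le_coe hf⟩

theorem fenchelConj_convexIndicator_singleton {E : Type*} [NormedAddCommGroup E] [NormedSpace ℝ E]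
    (x : E) (φ : StrongDual ℝ E) :
    fenchelConj (convexIndicator {x}) φ = ((φ x : ℝ) : EReal) := by
  refine le_antisymm (iSup_le fun v => ?_) ?_
  · by_cases hv : v = x
    · rw [convexIndicator_of_mem (show v ∈ ({x} : Set E) from hv), sub_zero, hv]
    · rw [convexIndicator_of_notMem (show v ∉ ({x} : Set E) from hv), EReal.sub_top]
      exact bot_le
  · refine le_trans (le_of_eq ?_)
      (le_iSup (fun v => ((φ v : ℝ) : EReal) - convexIndicator {x} v) x)
    rw [convexIndicator_of_mem (Set.mem_singleton x), sub_zero]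

theorem exists_coe_of_add_le {x y : EReal} {r : ℝ} (hx : x ≠ ⊥) (hy : y ≠ ⊥) (h : x + y ≤ r) :
    ∃ a b : ℝ, x = a ∧ y = b ∧ a + b ≤ r := by
  induction x with
  | bot => exact absurd rfl hx
  | top => rw [EReal.top_add_of_ne_bot hy] at h; simp at h
  | coe a =>
    induction y with
    | bot => exact absurd rfl hy
    | top => simp at h
    | coe b =>
      exact ⟨a, b, rfl, rfl, by rwa [← EReal.coe_add, EReal.coe_le_coe_iff] at h⟩

theorem exists_coe_of_mul_eq_coe {γ b : ℝ} (hγ : 0 < γ) {x : EReal}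
    (h : (γ : EReal) * x = b) : ∃ c : ℝ, x = c ∧ γ * c = b := by
  induction x with
  | bot => rw [EReal.coe_mul_bot_of_pos hγ] at h; simp at h
  | top => rw [EReal.coe_mul_top_of_pos hγ] at h; simp at h
  | coe c => exact ⟨c, rfl, by rwa [← EReal.coe_mul, EReal.coe_eq_coe_iff] at h⟩

theorem coe_mul_ne_bot {γ : ℝ} (hγ : 0 < γ) {x : EReal} (hx : x ≠ ⊥) : (γ : EReal) * x ≠ ⊥ := by
  induction x with
  | bot => exact absurd rfl hx
  | top => rw [EReal.coe_mul_top_of_pos hγ]; simp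
  | coe c => rw [← EReal.coe_mul]; exact EReal.coe_ne_bot _

/-! ### A separation argument -/

/-- Existence of a dual functional for the problem of minimizing `J (y - A v) + g` over a convex
set of pairs `(v, g)`, when `J` is a continuous convex function. -/
theorem exists_dual_functional {V H : Type*} [AddCommGroup V] [Module ℝ V]
    [NormedAddCommGroup H] [NormedSpace ℝ H] {J : H → ℝ} (hJ : ConvexOn ℝ Set.univ J)
    (hJc : Continuous J) {S : Set (V × ℝ)} (hS : Convex ℝ S) (hSne : S.Nonempty) (A : V →ₗ[ℝ] H)
    (y : H) {m : ℝ} (hm : ∀ x ∈ S, m ≤ J (y - A x.1) + x.2) :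
    ∃ η : StrongDual ℝ H, ∀ x ∈ S, ∀ e : H, η (e - y + A x.1) ≤ J e + x.2 - m := by
  -- The strict epigraph of the value function when y is perturbed by `c.1`.
  set C : Set (H × ℝ) := {c | ∃ x ∈ S, J (y + c.1 - A x.1) + x.2 < c.2} with hC
  have hCo : IsOpen C := by
    have : C = ⋃ x ∈ S, {c : H × ℝ | J (y + c.1 - A x.1) + x.2 < c.2} := by
      ext c; simp [hC]
    rw [this]
    refine isOpen_biUnion fun x _ => isOpen_lt ?_ continuous_snd
    fun_prop
  have hCc : Convex ℝ C := by
    rintro ⟨h, r⟩ ⟨x, hx, hxr⟩ ⟨h', r'⟩ ⟨x', hx', hxr'⟩ s t hs ht hst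
    refine ⟨s • x + t • x', hS hx hx' hs ht hst, ?_⟩
    have h1 : y + (s • (h, r) + t • (h', r')).1 - A (s • x + t • x').1 =
        s • (y + h - A x.1) + t • (y + h' - A x'.1) := by
      have hy : y = s • y + t • y := by rw [← add_smul, hst, one_smul]
      simp only [Prod.fst_add, Prod.smul_fst, map_add, map_smul]
      nth_rewrite 1 [hy]
      module
    have h2 := hJ.2 (Set.mem_univ (y + h - A x.1)) (Set.mem_univ (y + h' - A x'.1)) hs ht hst
    rw [h1]
    simp only [Prod.snd_add, Prod.smul_snd, smul_eq_mul] at h2 hxr hxr' ⊢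
    rcases hs.eq_or_lt with rfl | hs
    · have ht1 : t = 1 := by linarith
      subst ht1
      linarith
    · nlinarith [mul_lt_mul_of_pos_left hxr hs, mul_le_mul_of_nonneg_left hxr'.le ht]
  have hmC : ((0 : H), m) ∉ C := by
    rintro ⟨x, hx, hlt⟩
    have := hm x hx
    simp only [add_zero] at hlt
    linarith
  obtain ⟨f, hf⟩ := geometric_hahn_banach_open_point hCc hCo hmC
  have hfs : ∀ (h : H) (r : ℝ), f (h, r) = f (h, 0) + f (0, 1) * r := fun h r => by
    rw [mul_comm, ← smul_eq_mul, ← map_smul, ← map_add]; simp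
  set k := f (0, 1) with hk
  have hf0 : f ((0 : H), (0 : ℝ)) = 0 := map_zero f
  -- C contains a point vertically above (0, m), so the separating hyperplane is not vertical.
  have hk0 : k < 0 := by
    obtain ⟨x, hx⟩ := hSne
    have hlt := hf (0, J (y - A x.1) + x.2 + 1) ⟨x, hx, by simp⟩
    rw [hfs, hfs 0 m, hf0] at hlt
    have := hm x hx
    nlinarith
  refine ⟨-(k⁻¹ • f.comp (.inl ℝ H ℝ)), fun x hx e => ?_⟩
  -- The perturbation e - y + A v makes the argument of J equal to e. The slack ε lifts the point
  -- into the strict epigraph.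
  have hle : f (e - y + A x.1, 0) ≤ k * (m - (J e + x.2)) := by
    refine le_of_forall_pos_lt_add fun ε hε => ?_
    have hlt := hf (e - y + A x.1, J e + x.2 + ε / (-k)) ⟨x, hx, by
      have : y + (e - y + A x.1) - A x.1 = e := by abel
      simp only [this]
      have := div_pos hε (neg_pos.2 hk0)
      linarith⟩
    rw [hfs, hfs 0 m, hf0] at hlt
    have h3 : k * (J e + x.2 + ε / (-k)) = k * (J e + x.2) - ε := by
      have := hk0.ne
      field_simp
      ring
    rw [h3] at hlt
    linarith
  have h4 := mul_le_mul_of_nonpos_left hle (inv_lt_zero.2 hk0).le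
  rw [inv_mul_cancel_left₀ hk0.ne] at h4
  simp only [neg_apply, smul_apply, ContinuousLinearMap.comp_apply, ContinuousLinearMap.inl_apply,
    smul_eq_mul]
  linarith

/-! ### Operators of support vector regression -/

section

variable {X : Type*} {Y : Set ℝ} [MeasurableSpace (X × Y)] {P : Measure (X × Y)}
  {p q : ℝ≥0∞}

theorem mem_negOutput_iff (hy : MemLp (fun z : X × Y => (z.2 : ℝ)) p P) {h : Lp ℝ p P} :
    h ∈ negOutput p P ↔ h = -hy.toLp _ := by
  have h1 : (-hy.toLp _ : Lp ℝ p P) =ᵐ[P] fun z => -(z.2 : ℝ) := by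
    filter_upwards [Lp.coeFn_neg (hy.toLp _), hy.coeFn_toLp] with z h1 h2
    rw [h1, Pi.neg_apply, h2]
  rw [Lp.ext_iff]
  exact ⟨fun h => EventuallyEq.trans h h1.symm, fun h => EventuallyEq.trans h h1⟩

theorem negOutput_eq_singleton (hy : MemLp (fun z : X × Y => (z.2 : ℝ)) p P) :
    negOutput p P = {-hy.toLp _} :=
  Set.ext fun _ => mem_negOutput_iff hy

theorem integrable_Lp_mul [p.HolderConjugate q] (e : Lp ℝ p P) (u : Lp ℝ q P) : Integrable (fun z => e z * u z) P :=
  memLp_one_iff_integrable.1 ((Lp.memLp u).mul (r := 1) (Lp.memLp e))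

variable {F : Type*} [NormedAddCommGroup F] [NormedSpace ℝ F] {Φ : X → StrongDual ℝ F}

theorem integrable_smul_feature [p.HolderConjugate q]
    (hΦ : MemLp (fun z : X × Y => Φ z.1) p P) (u : Lp ℝ q P) :
    Integrable (fun z => u z • Φ z.1) P :=
  memLp_one_iff_integrable.1 (hΦ.smul (r := 1) (Lp.memLp u))

variable [Fact (1 ≤ p)] [Fact (1 ≤ q)]

theorem lpToDual_apply [p.HolderConjugate q] (u : Lp ℝ q P) (e : Lp ℝ p P) :
    lpToDual p q P u e = ∫ z, e z * u z ∂P :=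
  lpPairing_mul_apply e u

theorem lpToDual_toLp [p.HolderConjugate q] (u : Lp ℝ q P) {f : X × Y → ℝ} (hf : MemLp f p P) :
    lpToDual p q P u (hf.toLp f) = ∫ z, f z * u z ∂P := by
  rw [lpToDual_apply]
  exact integral_congr_ae (hf.coeFn_toLp.mono fun z hz => by simp only [hz])

variable [IsProbabilityMeasure P]

/-- The operator `w ↦ ⟨w, Φ(·)⟩`. -/
noncomputable def featureMap (hΦ : MemLp (fun z : X × Y => Φ z.1) p P) : F →L[ℝ] Lp ℝ p P :=
  (ContinuousLinearMap.holderL P p ∞ p (ContinuousLinearMap.id ℝ (StrongDual ℝ F) :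
    StrongDual ℝ F →L[ℝ] F →L[ℝ] ℝ) (hΦ.toLp _)).comp (Lp.constL ∞ P ℝ)

theorem coeFn_featureMap (hΦ : MemLp (fun z : X × Y => Φ z.1) p P) (w : F) :
    featureMap hΦ w =ᵐ[P] fun z => Φ z.1 w := by
  have h := (ContinuousLinearMap.id ℝ (StrongDual ℝ F) :
    StrongDual ℝ F →L[ℝ] F →L[ℝ] ℝ).coeFn_holder (r := p) (hΦ.toLp _) (Lp.const ∞ P w)
  filter_upwards [h, hΦ.coeFn_toLp, Lp.coeFn_const (p := ∞) (μ := P) (c := w)] with z h1 h2 h3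
  refine h1.trans ?_
  rw [h2, h3]
  rfl

/-- The operator `(w, b) ↦ ⟨w, Φ(·)⟩ + b`. -/
noncomputable def affineMap (hΦ : MemLp (fun z : X × Y => Φ z.1) p P) : F × ℝ →L[ℝ] Lp ℝ p P :=
  (featureMap hΦ).coprod (Lp.constL p P ℝ)

theorem coeFn_affineMap (hΦ : MemLp (fun z : X × Y => Φ z.1) p P) (w : F) (b : ℝ) :
    affineMap hΦ (w, b) =ᵐ[P] fun z => Φ z.1 w + b := by
  have h : affineMap hΦ (w, b) = featureMap hΦ w + Lp.const p P b := by
    rw [affineMap, ContinuousLinearMap.coprod_apply]; rfl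
  rw [h]
  filter_upwards [Lp.coeFn_add (featureMap hΦ w) (Lp.const p P b), coeFn_featureMap hΦ w,
    Lp.coeFn_const (p := p) (μ := P) (c := b)] with z h1 h2 h3
  rw [h1, Pi.add_apply, h2, h3]
  rfl

theorem mem_primalFeasible_iff (hΦ : MemLp (fun z : X × Y => Φ z.1) p P)
    (hy : MemLp (fun z : X × Y => (z.2 : ℝ)) p P) {w : F} {b : ℝ} {e : Lp ℝ p P} :
    (w, b, e) ∈ primalFeasible p P Φ ↔ e = hy.toLp _ - affineMap hΦ (w, b) := by
  have h : (hy.toLp _ - affineMap hΦ (w, b) : Lp ℝ p P) =ᵐ[P] residual Φ w b := by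
    filter_upwards [Lp.coeFn_sub (hy.toLp _) (affineMap hΦ (w, b)), hy.coeFn_toLp,
      coeFn_affineMap hΦ w b] with z h1 h2 h3
    rw [h1, Pi.sub_apply, h2, h3, residual]
    ring
  rw [Lp.ext_iff]
  constructor
  · intro (hf : residual Φ w b =ᵐ[P] e)
    exact (h.trans hf).symm
  · intro hf
    exact (hf.trans h).symm

/-- The operator `(w, b, e) ↦ -(⟨w, Φ(·)⟩ + b + e)`. -/
noncomputable def constraintMap (hΦ : MemLp (fun z : X × Y => Φ z.1) p P) :
    (F × ℝ × Lp ℝ p P) →L[ℝ] Lp ℝ p P :=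
  -((affineMap hΦ).comp ((ContinuousLinearMap.fst ℝ F (ℝ × Lp ℝ p P)).prod
      ((ContinuousLinearMap.fst ℝ ℝ (Lp ℝ p P)).comp (ContinuousLinearMap.snd ℝ F _))) +
    (ContinuousLinearMap.snd ℝ ℝ (Lp ℝ p P)).comp (ContinuousLinearMap.snd ℝ F _))

theorem constraintMap_apply (hΦ : MemLp (fun z : X × Y => Φ z.1) p P) (w : F) (b : ℝ)
    (e : Lp ℝ p P) : constraintMap hΦ (w, b, e) = -(affineMap hΦ (w, b) + e) := rfl

theorem coeFn_constraintMap (hΦ : MemLp (fun z : X × Y => Φ z.1) p P) (w : F) (b : ℝ)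
    (e : Lp ℝ p P) : constraintMap hΦ (w, b, e) =ᵐ[P] fun z => -(Φ z.1 w + b + e z) := by
  rw [constraintMap_apply]
  filter_upwards [Lp.coeFn_neg (affineMap hΦ (w, b) + e), Lp.coeFn_add (affineMap hΦ (w, b)) e,
    coeFn_affineMap hΦ w b] with z h1 h2 h3
  rw [h1, Pi.neg_apply, h2, Pi.add_apply, h3]

theorem constraintMap_mem_negOutput_iff (hΦ : MemLp (fun z : X × Y => Φ z.1) p P)
    (hy : MemLp (fun z : X × Y => (z.2 : ℝ)) p P) (v : F × ℝ × Lp ℝ p P) :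
    constraintMap hΦ v ∈ negOutput p P ↔ v ∈ primalFeasible p P Φ := by
  obtain ⟨w, b, e⟩ := v
  rw [mem_negOutput_iff hy, mem_primalFeasible_iff hΦ hy, constraintMap_apply, neg_inj,
    eq_sub_iff_add_eq, add_comm]

variable [p.HolderConjugate q]

/-- This computes the adjoint of A: u is sent to (∫ u Φ, ∫ u), which is where both the argument of
G* and the dual constraint come from. -/
theorem lpToDual_affineMap (hΦ : MemLp (fun z : X × Y => Φ z.1) p P) (u : Lp ℝ q P) (w : F)
    (b : ℝ) : lpToDual p q P u (affineMap hΦ (w, b)) =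
      featureIntegral P Φ u w + b * ∫ z, u z ∂P := by
  have hu : Integrable u P := (Lp.memLp u).integrable Fact.out
  have hi := integrable_smul_feature hΦ u
  rw [lpToDual_apply, featureIntegral, ContinuousLinearMap.integral_apply hi,
    ← integral_const_mul, ← integral_add (hi.apply_continuousLinearMap w) (hu.const_mul b)]
  refine integral_congr_ae ?_
  filter_upwards [coeFn_affineMap hΦ w b] with z hz
  rw [hz]
  simp only [smul_apply, smul_eq_mul]
  ring

end

/-! ### Weak and strong duality. -/

section

variable {X : Type*} {Y : Set ℝ} [MeasurableSpace (X × Y)] {P : Measure (X × Y)}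
  {F : Type*} {L : ℝ → ℝ} {γ : ℝ} {G : F → EReal} {p q : ℝ≥0∞}

theorem primalObjective_eq (hi : ∀ e : Lp ℝ p P, Integrable (fun z => L (e z)) P) (w : F) (b : ℝ)
    (e : Lp ℝ p P) :
    primalObjective p P L γ G (w, b, e) = ((γ * ∫ z, L (e z) ∂P : ℝ) : EReal) + G w := by
  rw [primalObjective, extIntegral_coe (hi e), EReal.coe_mul]

theorem primalObjective_le_coe_iff (hi : ∀ e : Lp ℝ p P, Integrable (fun z => L (e z)) P)
    {w : F} {b : ℝ} {e : Lp ℝ p P} {r : ℝ} :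
    primalObjective p P L γ G (w, b, e) ≤ r ↔
      G w ≤ ((r - γ * ∫ z, L (e z) ∂P : ℝ) : EReal) := by
  rw [primalObjective_eq hi, coe_add_le_coe_iff]

theorem integrable_div_mul [p.HolderConjugate q] (γ : ℝ) (u : Lp ℝ q P) (e : Lp ℝ p P) : Integrable (fun z => u z / γ * e z) P :=
  ((integrable_Lp_mul e u).div_const γ).congr (ae_of_all _ fun z => by simp only; ring)

theorem integral_div_mul (γ : ℝ) (u : Lp ℝ q P) (e : Lp ℝ p P) :
    ∫ z, u z / γ * e z ∂P = (∫ z, e z * u z ∂P) / γ := by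
  rw [← integral_div]
  exact integral_congr_ae (ae_of_all _ fun z => by simp only; ring)

variable [NormedAddCommGroup F] [NormedSpace ℝ F] {Φ : X → StrongDual ℝ F}

theorem primalObjective_ne_bot (hi : ∀ e : Lp ℝ p P, Integrable (fun z => L (e z)) P)
    (hG : IsGammaZero G) (v : F × ℝ × Lp ℝ p P) : primalObjective p P L γ G v ≠ ⊥ := by
  obtain ⟨w, b, e⟩ := v
  rw [primalObjective_eq hi, ne_eq, EReal.add_eq_bot_iff, not_or]
  exact ⟨EReal.coe_ne_bot _, hG.ne_bot w⟩

variable [IsProbabilityMeasure P]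

/-- Neither G* nor ∫ L*(u/γ) can be -∞, so a real upper bound on their sum forces both to be finite
and reduces the inequality to real arithmetic. -/
theorem dualObjective_le_coe_iff (hγ : 0 < γ) (hG : IsGammaZero G) {u : Lp ℝ q P} {r : ℝ} :
    dualObjective q P Φ L γ G u ≤ r ↔
      ∃ α β : ℝ, fenchelConj G (featureIntegral P Φ u) = α ∧
        extIntegral P (fun z => realConj L (u z / γ)) = β ∧
        α + γ * β - ∫ z, (z.2 : ℝ) * u z ∂P ≤ r := by
  constructor
  · intro h
    rw [dualObjective, sub_eq_add_neg, add_comm, ← EReal.coe_neg, coe_add_le_coe_iff] at h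
    obtain ⟨α, β', hα, hβ', hle⟩ := exists_coe_of_add_le (fenchelConj_ne_bot hG.proper _)
      (coe_mul_ne_bot hγ (extIntegral_realConj_ne_bot L _)) h
    obtain ⟨β, hβ, rfl⟩ := exists_coe_of_mul_eq_coe hγ hβ'
    exact ⟨α, β, hα, hβ, by linarith⟩
  · rintro ⟨α, β, hα, hβ, hle⟩
    rw [dualObjective, hα, hβ, ← EReal.coe_mul, ← EReal.coe_add, ← EReal.coe_sub]
    exact EReal.coe_le_coe_iff.2 hle

theorem dualObjective_ne_bot (hγ : 0 < γ) (hG : IsGammaZero G) (u : Lp ℝ q P) :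
    dualObjective q P Φ L γ G u ≠ ⊥ := by
  rw [dualObjective, sub_eq_add_neg, ← EReal.coe_neg, ne_eq, EReal.add_eq_bot_iff,
    EReal.add_eq_bot_iff, not_or, not_or]
  exact ⟨⟨fenchelConj_ne_bot hG.proper _, coe_mul_ne_bot hγ (extIntegral_realConj_ne_bot L _)⟩,
    EReal.coe_ne_bot _⟩

theorem dualObjective_add_indicator_le_coe_iff (hγ : 0 < γ) (hG : IsGammaZero G) {u : Lp ℝ q P}
    {r : ℝ} :
    dualObjective q P Φ L γ G u + convexIndicator (dualFeasible q P) u ≤ r ↔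
      ∫ z, u z ∂P = 0 ∧ dualObjective q P Φ L γ G u ≤ r := by
  by_cases hu : u ∈ dualFeasible q P
  · rw [convexIndicator_of_mem hu, add_zero]
    exact ⟨fun h => ⟨hu, h⟩, fun h => h.2⟩
  · rw [convexIndicator_of_notMem hu, EReal.add_top_of_ne_bot (dualObjective_ne_bot hγ hG u)]
    exact ⟨fun h => absurd h (by simp), fun h => absurd h.1 hu⟩

variable [Fact (1 ≤ p)] [Fact (1 ≤ q)] [p.HolderConjugate q]

theorem lpToDual_residual (hΦ : MemLp (fun z : X × Y => Φ z.1) p P)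
    (hy : MemLp (fun z : X × Y => (z.2 : ℝ)) p P) (u : Lp ℝ q P) (w : F) (b : ℝ)
    (e : Lp ℝ p P) :
    lpToDual p q P u (e - hy.toLp _ + affineMap hΦ (w, b)) =
      ∫ z, e z * u z ∂P - ∫ z, (z.2 : ℝ) * u z ∂P +
        (featureIntegral P Φ u w + b * ∫ z, u z ∂P) := by
  rw [map_add, map_sub, lpToDual_affineMap, lpToDual_toLp, lpToDual_apply]

/-- The dual objective is at most `r` exactly when `r` bounds the affine expressions whose supremum
is the conjugate of the primal objective. -/
theorem dual_le_coe_iff (hγ : 0 < γ) (hG : IsGammaZero G) (hLc : Continuous L)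
    (hi : ∀ e : Lp ℝ p P, Integrable (fun z => L (e z)) P)
    (hΦ : MemLp (fun z : X × Y => Φ z.1) p P) (hy : MemLp (fun z : X × Y => (z.2 : ℝ)) p P)
    {u : Lp ℝ q P} {r : ℝ} :
    (∫ z, u z ∂P = 0 ∧ dualObjective q P Φ L γ G u ≤ r) ↔
      ∀ (w : F) (b : ℝ) (e : Lp ℝ p P) (g : ℝ), G w ≤ g →
        lpToDual p q P u (e - hy.toLp _ + affineMap hΦ (w, b)) ≤
          γ * ∫ z, L (e z) ∂P + g + r := by
  have hsint : ∀ e : Lp ℝ p P, ∫ z, (u z / γ * e z - L (e z)) ∂P =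
      (∫ z, e z * u z ∂P) / γ - ∫ z, L (e z) ∂P := fun e => by
    rw [integral_sub (integrable_div_mul γ u e) (hi e), integral_div_mul]
  simp only [lpToDual_residual]
  constructor
  · rintro ⟨hu0, hle⟩ w b e g hg
    obtain ⟨α, β, hα, hβ, hle⟩ := (dualObjective_le_coe_iff hγ hG).1 hle
    have h1 := apply_le_of_fenchelConj_le hα.le hg
    have h2 := integral_le_extIntegral_realConj ((integrable_div_mul γ u e).sub (hi e))
    rw [hβ, EReal.coe_le_coe_iff, hsint] at h2
    have h3 := mul_le_mul_of_nonneg_left h2 hγ.le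
    rw [mul_sub, mul_div_cancel₀ _ hγ.ne'] at h3
    rw [hu0]
    linarith
  · intro H
    obtain ⟨w₀, g₀, hg₀⟩ := hG.exists_coe
    have hu0 : ∫ z, u z ∂P = 0 := by
      by_contra hne
      -- This b makes the left side exceed the right side by exactly 1, which is possible as soon as
      -- ∫ u ≠ 0.
      have h2 := H w₀ ((γ * ∫ z, L ((0 : Lp ℝ p P) z) ∂P + g₀ + r -
        (∫ z, (0 : Lp ℝ p P) z * u z ∂P - ∫ z, (z.2 : ℝ) * u z ∂P) -
          featureIntegral P Φ u w₀ + 1) / ∫ z, u z ∂P) 0 g₀ hg₀.le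
      rw [div_mul_cancel₀ _ hne] at h2
      linarith
    refine ⟨hu0, ?_⟩
    simp only [hu0, mul_zero, add_zero] at H
    -- The supremum over e is taken first, with (w, g) fixed. Once ∫ L*(u/γ) is known to be finite,
    -- the same inequality read in w bounds G*(∫ u Φ).
    have hbeta : ∀ (w : F) (g : ℝ), G w ≤ g →
        extIntegral P (fun z => realConj L (u z / γ)) ≤
          (((g + r + ∫ z, (z.2 : ℝ) * u z ∂P - featureIntegral P Φ u w) / γ : ℝ) : EReal) :=
      fun w g hg => by
        refine extIntegral_realConj_le hLc ((Lp.stronglyMeasurable u).measurable.div_const γ)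
          (((Lp.memLp u).integrable Fact.out).div_const γ) fun e hem ⟨C, hC⟩ => ?_
        have heL : MemLp e p P := MemLp.of_bound hem.aestronglyMeasurable C (ae_of_all _ hC)
        have h1 : ∫ z, (u z / γ * e z - L (e z)) ∂P =
            ∫ z, (u z / γ * heL.toLp e z - L (heL.toLp e z)) ∂P :=
          integral_congr_ae (heL.coeFn_toLp.mono fun z hz => by simp only [hz])
        rw [h1, hsint, le_div_iff₀ hγ, sub_mul, div_mul_cancel₀ _ hγ.ne']
        linarith [H w 0 (heL.toLp e) g hg]
    obtain ⟨β, hβ⟩ : ∃ β : ℝ, extIntegral P (fun z => realConj L (u z / γ)) = β :=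
      ⟨_, (EReal.coe_toReal (ne_top_of_le_ne_top (EReal.coe_ne_top _) (hbeta w₀ g₀ hg₀.le))
        (extIntegral_realConj_ne_bot L _)).symm⟩
    have halpha : fenchelConj G (featureIntegral P Φ u) ≤
        ((r + ∫ z, (z.2 : ℝ) * u z ∂P - γ * β : ℝ) : EReal) := by
      refine fenchelConj_le_coe hG.ne_bot fun w g hg => ?_
      have h1 := hbeta w g hg
      rw [hβ, EReal.coe_le_coe_iff, le_div_iff₀ hγ] at h1
      linarith
    obtain ⟨α, hα⟩ : ∃ α : ℝ, fenchelConj G (featureIntegral P Φ u) = α :=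
      ⟨_, (EReal.coe_toReal (ne_top_of_le_ne_top (EReal.coe_ne_top _) halpha)
        (fenchelConj_ne_bot hG.proper _)).symm⟩
    rw [hα, EReal.coe_le_coe_iff] at halpha
    exact (dualObjective_le_coe_iff hγ hG).2 ⟨α, β, hα, hβ, by linarith⟩

/-- The Fenchel–Rockafellar dual objective over `L^q`. -/
theorem frDual_lpToDual (hγ : 0 < γ) (hG : IsGammaZero G) (hLc : Continuous L)
    (hi : ∀ e : Lp ℝ p P, Integrable (fun z => L (e z)) P)
    (hΦ : MemLp (fun z : X × Y => Φ z.1) p P) (hy : MemLp (fun z : X × Y => (z.2 : ℝ)) p P)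
    (u : Lp ℝ q P) :
    frDual (primalObjective p P L γ G) (convexIndicator (negOutput p P)) (constraintMap hΦ)
        (lpToDual p q P u) =
      dualObjective q P Φ L γ G u + convexIndicator (dualFeasible q P) u := by
  refine eq_of_forall_le_coe_iff fun r => ?_
  -- The conjugate of the indicator of {-pr₂} is the real number ⟨-pr₂, u⟩. Moved to the other side,
  -- it leaves the same family of affine inequalities for both objectives.
  rw [dualObjective_add_indicator_le_coe_iff hγ hG, dual_le_coe_iff hγ hG hLc hi hΦ hy, frDual,
    negOutput_eq_singleton hy, fenchelConj_convexIndicator_singleton, add_comm,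
    coe_add_le_coe_iff, fenchelConj_le_coe_iff (primalObjective_ne_bot hi hG)]
  have hval : ∀ (w : F) (b : ℝ) (e : Lp ℝ p P),
      (-(lpToDual p q P u).comp (constraintMap hΦ)) (w, b, e) =
        lpToDual p q P u (affineMap hΦ (w, b) + e) := fun w b e => by
    rw [neg_apply, ContinuousLinearMap.comp_apply, constraintMap_apply, map_neg, neg_neg]
  have hsplit : ∀ (w : F) (b : ℝ) (e : Lp ℝ p P),
      lpToDual p q P u (e - hy.toLp _ + affineMap hΦ (w, b)) =
        lpToDual p q P u (affineMap hΦ (w, b) + e) + lpToDual p q P u (-hy.toLp _) :=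
    fun w b e => by rw [← map_add]; congr 1; abel
  constructor
  · intro h w b e g hg
    have h1 := h (w, b, e) (γ * ∫ z, L (e z) ∂P + g)
      ((primalObjective_le_coe_iff hi).2 (by simpa using hg))
    rw [hval] at h1
    rw [hsplit]
    linarith
  · rintro h ⟨w, b, e⟩ ρ hρ
    have h1 := h w b e _ ((primalObjective_le_coe_iff hi).1 hρ)
    rw [hsplit] at h1
    rw [hval]
    linarith

/-- Weak duality. -/
theorem neg_le_primalObjective (hγ : 0 < γ) (hG : IsGammaZero G) (hLc : Continuous L)
    (hi : ∀ e : Lp ℝ p P, Integrable (fun z => L (e z)) P)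
    (hΦ : MemLp (fun z : X × Y => Φ z.1) p P) (hy : MemLp (fun z : X × Y => (z.2 : ℝ)) p P)
    {u : Lp ℝ q P} (hu : u ∈ dualFeasible q P) {r : ℝ} (hr : dualObjective q P Φ L γ G u ≤ r)
    {v : F × ℝ × Lp ℝ p P} (hv : v ∈ primalFeasible p P Φ) :
    ((-r : ℝ) : EReal) ≤ primalObjective p P L γ G v := by
  obtain ⟨w, b, e⟩ := v
  refine le_of_forall_le_coe fun ρ hρ => EReal.coe_le_coe_iff.2 ?_
  have h1 := (dual_le_coe_iff hγ hG hLc hi hΦ hy).1 ⟨hu, hr⟩ w b e _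
    ((primalObjective_le_coe_iff hi).1 hρ)
  -- On feasible points the pairing term disappears, leaving 0 ≤ ρ + r.
  have h2 : e - hy.toLp _ + affineMap hΦ (w, b) = 0 := by
    rw [(mem_primalFeasible_iff hΦ hy).1 hv]; abel
  rw [h2, map_zero] at h1
  linarith

theorem neg_optimalValue_le_dualObjective (hγ : 0 < γ) (hG : IsGammaZero G) (hLc : Continuous L)
    (hi : ∀ e : Lp ℝ p P, Integrable (fun z => L (e z)) P)
    (hΦ : MemLp (fun z : X × Y => Φ z.1) p P) (hy : MemLp (fun z : X × Y => (z.2 : ℝ)) p P)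
    {u : Lp ℝ q P} (hu : u ∈ dualFeasible q P) :
    -optimalValue (primalObjective p P L γ G) (primalFeasible p P Φ) ≤
      dualObjective q P Φ L γ G u := by
  refine le_of_forall_le_coe fun r hr => ?_
  rw [EReal.neg_le, ← EReal.coe_neg]
  exact le_iInf₂ fun v hv => neg_le_primalObjective hγ hG hLc hi hΦ hy hu hr hv

theorem exists_primalFeasible_coe (hG : IsGammaZero G)
    (hi : ∀ e : Lp ℝ p P, Integrable (fun z => L (e z)) P)
    (hΦ : MemLp (fun z : X × Y => Φ z.1) p P) (hy : MemLp (fun z : X × Y => (z.2 : ℝ)) p P) :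
    ∃ v ∈ primalFeasible p P Φ, ∃ r : ℝ, primalObjective p P L γ G v = r := by
  obtain ⟨w, g, hg⟩ := hG.exists_coe
  refine ⟨(w, 0, _), (mem_primalFeasible_iff hΦ hy).2 rfl,
    γ * ∫ z, L ((hy.toLp _ - affineMap hΦ (w, 0) : Lp ℝ p P) z) ∂P + g, ?_⟩
  rw [primalObjective_eq hi, hg, ← EReal.coe_add]

/-- Strong duality with dual attainment. -/
theorem exists_dualObjective_le (hγ : 0 < γ) (hG : IsGammaZero G) (hp : p ≠ ∞)
    (hL : ConvexOn ℝ Set.univ L) (hLc : Continuous L)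
    (hi : ∀ e : Lp ℝ p P, Integrable (fun z => L (e z)) P)
    (hIc : Continuous fun e : Lp ℝ p P => ∫ z, L (e z) ∂P)
    (hΦ : MemLp (fun z : X × Y => Φ z.1) p P) (hy : MemLp (fun z : X × Y => (z.2 : ℝ)) p P) :
    ∃ u ∈ dualFeasible q P, dualObjective q P Φ L γ G u ≤
      -optimalValue (primalObjective p P L γ G) (primalFeasible p P Φ) := by
  set m := optimalValue (primalObjective p P L γ G) (primalFeasible p P Φ) with hm
  have hmle : ∀ v ∈ primalFeasible p P Φ, m ≤ primalObjective p P L γ G v :=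
    fun v hv => iInf₂_le v hv
  rcases eq_or_ne m ⊥ with hbot | hbot
  -- When m = -∞ the bound is +∞, so any dual feasible point serves.
  · refine ⟨0, ?_, by rw [hbot, EReal.neg_bot]; exact le_top⟩
    change ∫ z, (0 : Lp ℝ q P) z ∂P = 0
    rw [integral_congr_ae (Lp.coeFn_zero ℝ q P)]
    simp
  · have htop : m ≠ ⊤ := by
      obtain ⟨v, hv, r, hr⟩ := exists_primalFeasible_coe (γ := γ) hG hi hΦ hy
      exact ne_top_of_le_ne_top (EReal.coe_ne_top r) ((hmle v hv).trans hr.le)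
    obtain ⟨μ, hμ⟩ : ∃ μ : ℝ, m = μ := ⟨_, (EReal.coe_toReal htop hbot).symm⟩
    -- The epigraph of G, with b as an additional free coordinate.
    have hS : Convex ℝ {x : (F × ℝ) × ℝ | G x.1.1 ≤ (x.2 : EReal)} :=
      hG.convex_epigraph.linear_preimage
        (((LinearMap.fst ℝ F ℝ).comp (LinearMap.fst ℝ (F × ℝ) ℝ)).prod
          (LinearMap.snd ℝ (F × ℝ) ℝ))
    have hSne : {x : (F × ℝ) × ℝ | G x.1.1 ≤ (x.2 : EReal)}.Nonempty := by
      obtain ⟨w, g, hg⟩ := hG.exists_coe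
      exact ⟨((w, 0), g), hg.le⟩
    have hJ : ConvexOn ℝ Set.univ fun e : Lp ℝ p P => γ * ∫ z, L (e z) ∂P :=
      (convexOn_integral_comp hL hi).smul hγ.le
    obtain ⟨η, hη⟩ := exists_dual_functional hJ (continuous_const.mul hIc) hS hSne
      (affineMap hΦ : F × ℝ →ₗ[ℝ] Lp ℝ p P) (hy.toLp _) (m := μ) (by
        rintro ⟨⟨w, b⟩, g⟩ hx
        have h1 := hmle (w, b, _) ((mem_primalFeasible_iff hΦ hy).2 rfl)
        rw [hμ, primalObjective_eq hi] at h1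
        have h2 := h1.trans (add_le_add le_rfl hx)
        rw [← EReal.coe_add, EReal.coe_le_coe_iff] at h2
        exact h2)
    obtain ⟨u, rfl⟩ := (bijective_lpPairing_mul_flip (μ := P) (p := p) (q := q) hp).2 η
    have hdual : ∫ z, u z ∂P = 0 ∧ dualObjective q P Φ L γ G u ≤ ((-μ : ℝ) : EReal) := by
      refine (dual_le_coe_iff hγ hG hLc hi hΦ hy).2 fun w b e g hg => ?_
      exact (hη ((w, b), g) hg e).trans (le_of_eq (by ring))
    refine ⟨u, hdual.1, ?_⟩
    rw [hμ, ← EReal.coe_neg]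
    exact hdual.2

end

section

variable {X : Type*} {Y : Set ℝ} [MeasurableSpace (X × Y)] {P : Measure (X × Y)}
  {F : Type*} [NormedAddCommGroup F] [NormedSpace ℝ F] {Φ : X → StrongDual ℝ F}
  {L : ℝ → ℝ} {γ : ℝ} {G : F → EReal} {p q : ℝ≥0∞}

/-! ### Equivalence of the regression problem and the constrained problem -/

theorem primalObjective_eq_regObjective {w : F} {b : ℝ} {e : Lp ℝ p P}
    (h : (w, b, e) ∈ primalFeasible p P Φ) :
    primalObjective p P L γ G (w, b, e) = regObjective P Φ L γ G (w, b) := by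
  have h' : ∀ᵐ z ∂P, residual Φ w b z = e z := h
  rw [primalObjective, regObjective]
  congr 2
  exact extIntegral_congr_ae (h'.mono fun z hz => by simp only [hz])

theorem memLp_output [Fact (1 ≤ p)] (hp : p ≠ ∞) (hY : Measurable (fun z : X × Y => (z.2 : ℝ)))
    (h : Integrable (fun z : X × Y => |(z.2 : ℝ)| ^ p.toReal) P) :
    MemLp (fun z : X × Y => (z.2 : ℝ)) p P :=
  (integrable_norm_rpow_iff hY.aestronglyMeasurable
    (zero_lt_one.trans_le (Fact.out : 1 ≤ p)).ne' hp).1 h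

/-- Separability of the dual turns Borel measurability of Φ into strong measurability. -/
theorem memLp_feature [Fact (1 ≤ p)] [TopologicalSpace.SeparableSpace F]
    (hrefl : Function.Surjective (NormedSpace.inclusionInDoubleDual ℝ F)) (hp : p ≠ ∞)
    (hΦ : Measurable (fun z : X × Y => Φ z.1))
    (h : Integrable (fun z : X × Y => ‖Φ z.1‖ ^ p.toReal) P) :
    MemLp (fun z : X × Y => Φ z.1) p P := by
  have := NormedSpace.separableSpace_dual_of_reflexive hrefl
  have := UniformSpace.secondCountable_of_separable (StrongDual ℝ F)
  exact (integrable_norm_rpow_iff hΦ.aestronglyMeasurable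
    (zero_lt_one.trans_le (Fact.out : 1 ≤ p)).ne' hp).1 h

variable [IsProbabilityMeasure P] [Fact (1 ≤ p)]

theorem existsUnique_primalFeasible (hΦ : MemLp (fun z : X × Y => Φ z.1) p P)
    (hy : MemLp (fun z : X × Y => (z.2 : ℝ)) p P) (w : F) (b : ℝ) :
    ∃! e : Lp ℝ p P, (w, b, e) ∈ primalFeasible p P Φ :=
  ⟨_, (mem_primalFeasible_iff hΦ hy).2 rfl, fun _ he => (mem_primalFeasible_iff hΦ hy).1 he⟩

theorem optimalValue_regObjective (hΦ : MemLp (fun z : X × Y => Φ z.1) p P)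
    (hy : MemLp (fun z : X × Y => (z.2 : ℝ)) p P) :
    optimalValue (regObjective P Φ L γ G) Set.univ =
      optimalValue (primalObjective p P L γ G) (primalFeasible p P Φ) := by
  refine le_antisymm (le_iInf₂ fun v hv => ?_) (le_iInf₂ fun v _ => ?_)
  · obtain ⟨w, b, e⟩ := v
    rw [primalObjective_eq_regObjective hv]
    exact iInf₂_le (w, b) (Set.mem_univ _)
  · obtain ⟨w, b⟩ := v
    obtain ⟨e, he, -⟩ := existsUnique_primalFeasible hΦ hy w b
    rw [← primalObjective_eq_regObjective he]
    exact iInf₂_le _ he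

theorem isSolution_regObjective_iff (hΦ : MemLp (fun z : X × Y => Φ z.1) p P)
    (hy : MemLp (fun z : X × Y => (z.2 : ℝ)) p P) (w : F) (b : ℝ) :
    IsSolution (regObjective P Φ L γ G) Set.univ (w, b) ↔
      ∃ e : Lp ℝ p P, IsSolution (primalObjective p P L γ G) (primalFeasible p P Φ) (w, b, e) := by
  constructor
  · rintro ⟨-, hmin⟩
    obtain ⟨e, he, -⟩ := existsUnique_primalFeasible hΦ hy w b
    refine ⟨e, he, fun v hv => ?_⟩
    obtain ⟨w', b', e'⟩ := v
    rw [primalObjective_eq_regObjective he, primalObjective_eq_regObjective hv]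
    exact hmin _ (Set.mem_univ _)
  · rintro ⟨e, he, hmin⟩
    refine ⟨Set.mem_univ _, fun v _ => ?_⟩
    obtain ⟨w', b'⟩ := v
    obtain ⟨e', he', -⟩ := existsUnique_primalFeasible hΦ hy w' b'
    rw [← primalObjective_eq_regObjective he, ← primalObjective_eq_regObjective he']
    exact hmin _ he'

theorem frPrimal_constraintMap (hΦ : MemLp (fun z : X × Y => Φ z.1) p P)
    (hy : MemLp (fun z : X × Y => (z.2 : ℝ)) p P) (v : F × ℝ × Lp ℝ p P) :
    frPrimal (primalObjective p P L γ G) (convexIndicator (negOutput p P)) (constraintMap hΦ) v =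
      primalObjective p P L γ G v + convexIndicator (primalFeasible p P Φ) v := by
  rw [frPrimal]
  congr 1
  by_cases h : v ∈ primalFeasible p P Φ
  · rw [convexIndicator_of_mem h,
      convexIndicator_of_mem ((constraintMap_mem_negOutput_iff hΦ hy v).2 h)]
  · rw [convexIndicator_of_notMem h,
      convexIndicator_of_notMem (mt (constraintMap_mem_negOutput_iff hΦ hy v).1 h)]

/-! ### Optimality conditions -/

variable [Fact (1 ≤ q)] [p.HolderConjugate q]

theorem featureIntegral_apply_of_feasible (hΦ : MemLp (fun z : X × Y => Φ z.1) p P)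
    (hy : MemLp (fun z : X × Y => (z.2 : ℝ)) p P) {w : F} {b : ℝ} {e : Lp ℝ p P} {u : Lp ℝ q P}
    (hf : (w, b, e) ∈ primalFeasible p P Φ) (hu : ∫ z, u z ∂P = 0) :
    featureIntegral P Φ u w = ∫ z, (z.2 : ℝ) * u z ∂P - ∫ z, e z * u z ∂P := by
  have h := lpToDual_residual hΦ hy u w b e
  have h0 : e - hy.toLp _ + affineMap hΦ (w, b) = 0 := by
    rw [(mem_primalFeasible_iff hΦ hy).1 hf]; abel
  rw [h0, map_zero, hu] at h
  linarith

/-- For feasible points with finite values, ⟨w, ∫ u Φ⟩ = ∫ y u - ∫ e u splits the sum of the primal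
and dual objectives into the Fenchel–Young gap of G at (w, ∫ u Φ) and γ times the integrated gap of
L at (e, u/γ). Both are nonnegative, so a zero sum means equality in each. -/
theorem isSolution_pair_iff (hγ : 0 < γ) (hG : IsGammaZero G) (hp : p ≠ ∞)
    (hL : ConvexOn ℝ Set.univ L) (hLc : Continuous L)
    (hi : ∀ e : Lp ℝ p P, Integrable (fun z => L (e z)) P)
    (hIc : Continuous fun e : Lp ℝ p P => ∫ z, L (e z) ∂P)
    (hΦ : MemLp (fun z : X × Y => Φ z.1) p P) (hy : MemLp (fun z : X × Y => (z.2 : ℝ)) p P)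
    (w : F) (b : ℝ) (e : Lp ℝ p P) (u : Lp ℝ q P) :
    (IsSolution (primalObjective p P L γ G) (primalFeasible p P Φ) (w, b, e) ∧
      IsSolution (dualObjective q P Φ L γ G) (dualFeasible q P) u) ↔
    (NormedSpace.inclusionInDoubleDual ℝ F w ∈
        subdifferential (fenchelConj G) (featureIntegral P Φ u) ∧
      ∫ z, u z ∂P = 0 ∧
      (∀ᵐ z ∂P, u z / γ ∈ realSubdifferential L (e z)) ∧
      (∀ᵐ z ∂P, (z.2 : ℝ) - Φ z.1 w - b = e z)) := by
  have hsub := ae_mem_realSubdifferential_iff (μ := P) (s := fun z => u z / γ) (e := e) hLc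
    ((Lp.stronglyMeasurable u).measurable.div_const γ).aemeasurable (integrable_div_mul γ u e) (hi e)
  rw [integral_div_mul] at hsub
  rw [hG.mem_subdifferential_fenchelConj_iff, hsub]
  constructor
  · rintro ⟨⟨hf, hmin⟩, ⟨hu0, humin⟩⟩
    have hu0' : ∫ z, u z ∂P = 0 := hu0
    -- Comparison with a feasible point of finite value makes G(w) finite.
    obtain ⟨v₀, hv₀, r₀, hr₀⟩ := exists_primalFeasible_coe (γ := γ) hG hi hΦ hy
    have hGw := (primalObjective_le_coe_iff hi).1 ((hmin v₀ hv₀).trans hr₀.le)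
    obtain ⟨g, hg⟩ : ∃ g : ℝ, G w = g :=
      ⟨_, (EReal.coe_toReal (ne_top_of_le_ne_top (EReal.coe_ne_top _) hGw) (hG.ne_bot w)).symm⟩
    have hval : optimalValue (primalObjective p P L γ G) (primalFeasible p P Φ) =
        ((γ * ∫ z, L (e z) ∂P + g : ℝ) : EReal) := by
      rw [EReal.coe_add, ← hg, ← primalObjective_eq hi w b e]
      exact le_antisymm (iInf₂_le _ hf) (le_iInf₂ hmin)
    obtain ⟨u₀, hu₀, hle⟩ := exists_dualObjective_le (q := q) hγ hG hp hL hLc hi hIc hΦ hy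
    rw [hval, ← EReal.coe_neg] at hle
    obtain ⟨α, β, hα, hβ, hle⟩ :=
      (dualObjective_le_coe_iff hγ hG).1 ((humin u₀ hu₀).trans hle)
    have h1 := apply_le_of_fenchelConj_le hα.le hg.le
    have h2 := integral_le_extIntegral_realConj ((integrable_div_mul γ u e).sub (hi e))
    rw [hβ, EReal.coe_le_coe_iff, integral_sub (integrable_div_mul γ u e) (hi e),
      integral_div_mul] at h2
    have h3 := mul_le_mul_of_nonneg_left h2 hγ.le
    rw [mul_sub, mul_div_cancel₀ _ hγ.ne'] at h3
    have h4 := featureIntegral_apply_of_feasible hΦ hy hf hu0'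
    refine ⟨⟨g, α, hg, hα, by linarith⟩, hu0', ?_, hf⟩
    rw [hβ, EReal.coe_eq_coe_iff]
    refine le_antisymm ?_ h2
    refine le_of_mul_le_mul_left ?_ hγ
    rw [mul_sub, mul_div_cancel₀ _ hγ.ne']
    linarith
  · rintro ⟨⟨g, α, hg, hα, hgα⟩, hu0, hβ, hf⟩
    have hf' : (w, b, e) ∈ primalFeasible p P Φ := hf
    -- The two equalities make the dual value at most minus the primal one; weak duality then gives
    -- optimality of both points.
    have hle : dualObjective q P Φ L γ G u ≤ ((-(γ * ∫ z, L (e z) ∂P + g) : ℝ) : EReal) := by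
      refine (dualObjective_le_coe_iff hγ hG).2 ⟨α, _, hα, hβ, ?_⟩
      rw [mul_sub, mul_div_cancel₀ _ hγ.ne']
      linarith [featureIntegral_apply_of_feasible hΦ hy hf' hu0]
    have hP : primalObjective p P L γ G (w, b, e) = ((γ * ∫ z, L (e z) ∂P + g : ℝ) : EReal) := by
      rw [primalObjective_eq hi, hg, EReal.coe_add]
    refine ⟨⟨hf', fun v hv => ?_⟩, hu0, fun u' hu' => ?_⟩
    · rw [hP]
      simpa using neg_le_primalObjective hγ hG hLc hi hΦ hy hu0 hle hv
    · refine hle.trans (le_trans ?_ (neg_optimalValue_le_dualObjective hγ hG hLc hi hΦ hy hu'))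
      rw [EReal.coe_neg, EReal.neg_le_neg_iff, ← hP]
      exact iInf₂_le _ hf'

end

end SVR

theorem mainTheorem1
    {X : Type*} {Y : Set ℝ} [MeasurableSpace (X × Y)]
    (P : Measure (X × Y)) [IsProbabilityMeasure P]
    {F : Type*} [NormedAddCommGroup F] [NormedSpace ℝ F] [CompleteSpace F]
    [TopologicalSpace.SeparableSpace F]
    (hrefl : Function.Surjective (NormedSpace.inclusionInDoubleDual ℝ F))
    (Φ : X → StrongDual ℝ F)
    (hΦ : Measurable (fun z : X × Y => Φ z.1))
    (hY : Measurable (fun z : X × Y => (z.2 : ℝ)))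
    (L : ℝ → ℝ) (hL0 : ∀ t, 0 ≤ L t) (hL : ConvexOn ℝ Set.univ L)
    (p q : ℝ≥0∞) [Fact (1 ≤ p)] [Fact (1 ≤ q)] (hp : p ≠ ∞) [p.HolderConjugate q]
    (γ : ℝ) (hγ : 0 < γ)
    (G : F → EReal) (hG : SVR.IsGammaZero G)
    (hA2 : ∃ a b : ℝ, 0 ≤ a ∧ 0 ≤ b ∧ ∀ t : ℝ, L t ≤ a + b * |t| ^ p.toReal)
    (hA3y : Integrable (fun z : X × Y => |(z.2 : ℝ)| ^ p.toReal) P)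
    (hA3Φ : Integrable (fun z : X × Y => ‖Φ z.1‖ ^ p.toReal) P) :
    -- all the integrals below are well defined
    ((∀ e : Lp ℝ p P, Integrable (fun z => L (e z)) P) ∧
      (∀ u : Lp ℝ q P,
        Integrable (fun z => u z) P ∧
        Integrable (fun z => u z • Φ z.1) P ∧
        Integrable (fun z => (z.2 : ℝ) * u z) P ∧
        AEMeasurable (fun z => SVR.realConj L (u z / γ)) P ∧
        ∫⁻ z, (-SVR.realConj L (u z / γ)).toENNReal ∂P ≠ ∞)) ∧
    -- the regression problem is equivalent to the constrained problem
    ((∀ (w : F) (b : ℝ), ∃! e : Lp ℝ p P, (w, b, e) ∈ SVR.primalFeasible p P Φ) ∧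
      (∀ (w : F) (b : ℝ) (e : Lp ℝ p P), (w, b, e) ∈ SVR.primalFeasible p P Φ →
        SVR.primalObjective p P L γ G (w, b, e) = SVR.regObjective P Φ L γ G (w, b)) ∧
      SVR.optimalValue (SVR.regObjective P Φ L γ G) Set.univ =
        SVR.optimalValue (SVR.primalObjective p P L γ G) (SVR.primalFeasible p P Φ) ∧
      (∀ (w : F) (b : ℝ), SVR.IsSolution (SVR.regObjective P Φ L γ G) Set.univ (w, b) ↔
        ∃ e : Lp ℝ p P, SVR.IsSolution (SVR.primalObjective p P L γ G)
          (SVR.primalFeasible p P Φ) (w, b, e))) ∧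
    -- the Fenchel–Rockafellar dual of the constrained problem is the problem over `L^{p*}(P)`
    (Function.Bijective (SVR.lpToDual p q P) ∧
      ∃ T : (F × ℝ × Lp ℝ p P) →L[ℝ] Lp ℝ p P,
        (∀ (w : F) (b : ℝ) (e : Lp ℝ p P),
          ∀ᵐ z ∂P, T (w, b, e) z = -(Φ z.1 w + b + e z)) ∧
        (∀ v : F × ℝ × Lp ℝ p P,
          SVR.frPrimal (SVR.primalObjective p P L γ G)
              (SVR.convexIndicator (SVR.negOutput p P)) T v =
            SVR.primalObjective p P L γ G v +
              SVR.convexIndicator (SVR.primalFeasible p P Φ) v) ∧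
        (∀ u : Lp ℝ q P,
          SVR.frDual (SVR.primalObjective p P L γ G)
              (SVR.convexIndicator (SVR.negOutput p P)) T (SVR.lpToDual p q P u) =
            SVR.dualObjective q P Φ L γ G u + SVR.convexIndicator (SVR.dualFeasible q P) u)) ∧
    -- the dual problem has solutions
    (∃ u : Lp ℝ q P, SVR.IsSolution (SVR.dualObjective q P Φ L γ G) (SVR.dualFeasible q P) u) ∧
    -- strong duality
    SVR.optimalValue (SVR.primalObjective p P L γ G) (SVR.primalFeasible p P Φ) =
      -SVR.optimalValue (SVR.dualObjective q P Φ L γ G) (SVR.dualFeasible q P) ∧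
    -- optimality conditions
    (∀ (w : F) (b : ℝ) (e : Lp ℝ p P) (u : Lp ℝ q P),
      (SVR.IsSolution (SVR.primalObjective p P L γ G) (SVR.primalFeasible p P Φ) (w, b, e) ∧
        SVR.IsSolution (SVR.dualObjective q P Φ L γ G) (SVR.dualFeasible q P) u) ↔
      (NormedSpace.inclusionInDoubleDual ℝ F w ∈
          SVR.subdifferential (SVR.fenchelConj G) (SVR.featureIntegral P Φ u) ∧
        ∫ z, u z ∂P = 0 ∧
        (∀ᵐ z ∂P, u z / γ ∈ SVR.realSubdifferential L (e z)) ∧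
        (∀ᵐ z ∂P, (z.2 : ℝ) - Φ z.1 w - b = e z))) := by
  obtain ⟨a, b, _, hb, hab⟩ := hA2
  have hLc : Continuous L := continuousOn_univ.1 (hL.continuousOn isOpen_univ)
  have hy := SVR.memLp_output hp hY hA3y
  have hΦL := SVR.memLp_feature hrefl hp hΦ hA3Φ
  have hi : ∀ e : Lp ℝ p P, Integrable (fun z => L (e z)) P := fun e =>
    SVR.integrable_comp_of_growth hp hL0 hLc hab (Lp.memLp e)
  have hIc := SVR.continuous_integral_comp hp hL hi hb hab
  obtain ⟨u₀, hu₀, hle₀⟩ := SVR.exists_dualObjective_le (q := q) hγ hG hp hL hLc hi hIc hΦL hy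
  have hweak : ∀ u ∈ SVR.dualFeasible q P,
      -SVR.optimalValue (SVR.primalObjective p P L γ G) (SVR.primalFeasible p P Φ) ≤
        SVR.dualObjective q P Φ L γ G u := fun u hu =>
    SVR.neg_optimalValue_le_dualObjective hγ hG hLc hi hΦL hy hu
  refine ⟨⟨hi, fun u => ⟨(Lp.memLp u).integrable Fact.out, SVR.integrable_smul_feature hΦL u,
      memLp_one_iff_integrable.1 ((Lp.memLp u).mul (r := 1) hy),
      (SVR.measurable_realConj hLc).comp_aemeasurable
        ((Lp.stronglyMeasurable u).measurable.div_const γ).aemeasurable,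
      SVR.lintegral_neg_realConj_ne_top L _⟩⟩,
    ⟨SVR.existsUnique_primalFeasible hΦL hy, fun _ _ _ h => SVR.primalObjective_eq_regObjective h,
      SVR.optimalValue_regObjective hΦL hy, SVR.isSolution_regObjective_iff hΦL hy⟩,
    ⟨bijective_lpPairing_mul_flip hp, SVR.constraintMap hΦL, SVR.coeFn_constraintMap hΦL,
      SVR.frPrimal_constraintMap hΦL hy, SVR.frDual_lpToDual hγ hG hLc hi hΦL hy⟩,
    ⟨u₀, hu₀, fun u hu => hle₀.trans (hweak u hu)⟩, ?_,
    SVR.isSolution_pair_iff hγ hG hp hL hLc hi hIc hΦL hy⟩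
  -- Weak duality gives one inequality, the attaining point u₀ the other.
  rw [← neg_eq_iff_eq_neg]
  exact le_antisymm (le_iInf₂ hweak) ((iInf₂_le u₀ hu₀).trans hle₀)
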